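/- Theorem 1.4 (exterior estimate). For $h>0$ and a finite real signed Borel measure $V$ on $\mathbb R$, let $P=-h^2\partial_x^2+V$ be the operator on $L^2(\mathbb R)=L^2(\mathbb R;\mathbb C)$ with domain $$\mathcal D=\{u\in H^1(\mathbb R): u'\in L^\infty(\mathbb R),\ Pu\in L^2(\mathbb R)\},\qquad Pu:=-h^2u''+u_cV \text{ in the sense of distributions,}$$ where $u_c$ is the continuous representative of $u$. Fix $\delta>0$, $E>0$ and $R_0>0$, and set $h_0=\frac{1}{2\delta(1+R_0)^{\delta}}$. There is a constant $C>0$, depending only on $R_0$, $E$ and $\delta$, such that for every $h\in(0,h_0]$, every finite real signed Borel measure $V$ (which may depend on $h$) supported in $[-R_0,R_0]$, every $\varepsilon\in(0,1]$, and either choice of sign, $P-E\pm i\varepsilon:\mathcal D\to L^2(\mathbb R)$ has a bounded two-sided inverse on $L^2(\mathbb R)$ and $$\Big\|(|x|+1)^{-\frac{1+\delta}{2}}\,\mathbf 1_{>R_0}\,(P-E\pm i\varepsilon)^{-1}\,\mathbf 1_{>R_0}\,(|x|+1)^{-\frac{1+\delta}{2}}\Big\|_{L^2(\mathbb R)\to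 L^2(\mathbb R)}\le\frac{C}{h},$$ where $\mathbf 1_{>R_0}$ is (multiplication by) the characteristic function of $\{x:|x|>R_0\}$. -/

import Mathlib

open MeasureTheory
open scoped ENNReal ContDiff

noncomputable section

/-- The complex Hilbert space `L²(ℝ)` with respect to Lebesgue measure. -/
abbrev L2 : Type := Lp ℂ 2 (volume : Measure ℝ)

/-- `φ ∈ C₀^∞(ℝ; ℂ)`. -/
def IsTest (φ : ℝ → ℂ) : Prop := ContDiff ℝ ∞ φ ∧ HasCompactSupport φ

/-- `v` is the distributional derivative of `u`. -/
def HasWeakDeriv (u v : ℝ → ℂ) : Prop :=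
  ∀ φ : ℝ → ℂ, IsTest φ → ∫ x, u x * deriv φ x = -∫ x, v x * φ x

/-- The integral of `f` against a finite signed Borel measure, through its Jordan decomposition. -/
def signedIntegral (V : SignedMeasure ℝ) (f : ℝ → ℂ) : ℂ :=
  (∫ x, f x ∂V.toJordanDecomposition.posPart) - (∫ x, f x ∂V.toJordanDecomposition.negPart)

/-- `c` is the continuous representative of `u`. -/
def IsContRep (u : L2) (c : ℝ → ℂ) : Prop := Continuous c ∧ u =ᵐ[volume] c

/-- `-h² u'' + c V = g` in the sense of distributions on `ℝ`. -/
def SchrodingerEq (h : ℝ) (V : SignedMeasure ℝ) (u c g : ℝ → ℂ) : Prop :=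
  ∀ φ : ℝ → ℂ, IsTest φ →
    ∫ x, g x * φ x =
      -(h : ℂ) ^ 2 * (∫ x, u x * iteratedDeriv 2 φ x) + signedIntegral V (fun x => c x * φ x)

/-- `u` belongs to the domain `{u ∈ H¹(ℝ) : u' ∈ L^∞(ℝ), P u ∈ L²(ℝ)}` and `P u = g`, where
`P u = -h² u'' + u_c V` in the sense of distributions. Here `v = u'` is the weak derivative, and `c`
is the continuous representative `u_c`, which every `u ∈ H¹(ℝ)` has and which is unique. -/
def IsSchrodingerPair (h : ℝ) (V : SignedMeasure ℝ) (u g : L2) : Prop :=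
  ∃ v : L2, HasWeakDeriv u v ∧ MemLp v ∞ (volume : Measure ℝ) ∧
    ∃ c : ℝ → ℂ, IsContRep u c ∧ SchrodingerEq h V u c g

theorem IsTest.deriv {φ : ℝ → ℂ} (hφ : IsTest φ) : IsTest (deriv φ) :=
  ⟨(contDiff_infty_iff_deriv.1 hφ.1).2, hφ.2.deriv⟩

theorem IsTest.iteratedDeriv_two {φ : ℝ → ℂ} (hφ : IsTest φ) : IsTest (iteratedDeriv 2 φ) := by
  simpa [iteratedDeriv_succ, iteratedDeriv_zero] using hφ.deriv.deriv

theorem IsTest.integrable_mul {φ : ℝ → ℂ} (hφ : IsTest φ) (u : L2) :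
    Integrable (fun x => u x * φ x) :=
  (Lp.memLp u).integrable_mul (q := 2) (hφ.1.continuous.memLp_of_hasCompactSupport hφ.2)

theorem IsTest.integrable_mul_of_continuous {φ : ℝ → ℂ} (hφ : IsTest φ) {c : ℝ → ℂ}
    (hc : Continuous c) (μ : Measure ℝ) [IsFiniteMeasure μ] :
    Integrable (fun x => c x * φ x) μ :=
  (hc.mul hφ.1.continuous).integrable_of_hasCompactSupport hφ.2.mul_left

theorem integral_congr_mul {u v φ : ℝ → ℂ} (h : u =ᵐ[volume] v) :
    ∫ x, u x * φ x = ∫ x, v x * φ x :=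
  integral_congr_ae (h.mono fun x hx => by simp only [hx])

theorem isSchrodingerPair_zero (h : ℝ) (V : SignedMeasure ℝ) : IsSchrodingerPair h V 0 0 := by
  have h0 : ((0 : L2) : ℝ → ℂ) =ᵐ[volume] fun _ => 0 := Lp.coeFn_zero ℂ 2 volume
  refine ⟨0, fun φ hφ => ?_, ?_, fun _ => 0, ⟨continuous_const, h0⟩, fun φ hφ => ?_⟩
  · rw [integral_congr_mul h0, integral_congr_mul h0]; simp
  · exact (memLp_congr_ae h0).2 (MemLp.zero')
  · rw [integral_congr_mul h0, integral_congr_mul h0]; simp [signedIntegral]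

theorem IsSchrodingerPair.add {h : ℝ} {V : SignedMeasure ℝ} {u₁ u₂ g₁ g₂ : L2}
    (H₁ : IsSchrodingerPair h V u₁ g₁) (H₂ : IsSchrodingerPair h V u₂ g₂) :
    IsSchrodingerPair h V (u₁ + u₂) (g₁ + g₂) := by
  obtain ⟨v₁, hv₁, hb₁, c₁, hc₁, he₁⟩ := H₁
  obtain ⟨v₂, hv₂, hb₂, c₂, hc₂, he₂⟩ := H₂
  have key : ∀ (a b : L2) (φ : ℝ → ℂ), IsTest φ →
      ∫ x, (a + b : L2) x * φ x = (∫ x, a x * φ x) + ∫ x, b x * φ x := by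
    intro a b φ hφ
    rw [integral_congr_mul (Lp.coeFn_add a b),
      ← integral_add (hφ.integrable_mul a) (hφ.integrable_mul b)]
    simp only [Pi.add_apply, add_mul]
  refine ⟨v₁ + v₂, fun φ hφ => ?_, ?_, fun x => c₁ x + c₂ x, ⟨hc₁.1.add hc₂.1, ?_⟩, fun φ hφ => ?_⟩
  · rw [key _ _ _ hφ.deriv, key _ _ _ hφ, hv₁ φ hφ, hv₂ φ hφ]; ring
  · exact (memLp_congr_ae (Lp.coeFn_add v₁ v₂)).2 (hb₁.add hb₂)
  · filter_upwards [Lp.coeFn_add u₁ u₂, hc₁.2, hc₂.2] with x h1 h2 h3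
    rw [h1, Pi.add_apply, h2, h3]
  · rw [key _ _ _ hφ, key _ _ _ hφ.iteratedDeriv_two, he₁ φ hφ, he₂ φ hφ]
    simp only [signedIntegral, add_mul]
    rw [integral_add (hφ.integrable_mul_of_continuous hc₁.1 _)
        (hφ.integrable_mul_of_continuous hc₂.1 _),
      integral_add (hφ.integrable_mul_of_continuous hc₁.1 _)
        (hφ.integrable_mul_of_continuous hc₂.1 _)]
    ring

theorem IsSchrodingerPair.smul {h : ℝ} {V : SignedMeasure ℝ} {u g : L2} (a : ℂ)
    (H : IsSchrodingerPair h V u g) : IsSchrodingerPair h V (a • u) (a • g) := by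
  obtain ⟨v, hv, hb, c, hc, he⟩ := H
  have key : ∀ (b : L2) (φ : ℝ → ℂ),
      ∫ x, (a • b : L2) x * φ x = a * ∫ x, b x * φ x := by
    intro b φ
    rw [integral_congr_mul (Lp.coeFn_smul a b), ← integral_const_mul]
    simp only [Pi.smul_apply, smul_eq_mul, mul_assoc]
  refine ⟨a • v, fun φ hφ => ?_, ?_, fun x => a * c x, ⟨hc.1.const_mul a, ?_⟩, fun φ hφ => ?_⟩
  · rw [key, key, hv φ hφ]; ring
  · exact (memLp_congr_ae (Lp.coeFn_smul a v)).2 (hb.const_smul a)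
  · filter_upwards [Lp.coeFn_smul a u, hc.2] with x h1 h2
    rw [h1, Pi.smul_apply, h2, smul_eq_mul]
  · rw [key, key, he φ hφ]
    simp only [signedIntegral, mul_assoc, integral_const_mul]
    ring

/-- `P u` is determined by `u`: only `g = 0` can be `P 0`. -/
theorem IsSchrodingerPair.eq_zero {h : ℝ} {V : SignedMeasure ℝ} {g : L2}
    (H : IsSchrodingerPair h V 0 g) : g = 0 := by
  obtain ⟨v, -, -, c, hc, he⟩ := H
  have h0 : ((0 : L2) : ℝ → ℂ) =ᵐ[volume] fun _ => 0 := Lp.coeFn_zero ℂ 2 volume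
  have hc0 : c = fun _ => 0 :=
    (hc.1.ae_eq_iff_eq (μ := volume) continuous_const).1 (hc.2.symm.trans h0)
  have hg : ∀ᵐ x, g x = 0 := by
    refine ae_eq_zero_of_integral_contDiff_smul_eq_zero
      ((Lp.memLp g).locallyIntegrable (by norm_num)) fun φ hφ hs => ?_
    have ht : IsTest (fun x => (φ x : ℂ)) :=
      ⟨Complex.ofRealCLM.contDiff.comp hφ, hs.comp_left (g := ((↑) : ℝ → ℂ)) Complex.ofReal_zero⟩
    have := he _ ht
    rw [integral_congr_mul h0, hc0] at this
    simp only [zero_mul, integral_zero, mul_zero, signedIntegral, sub_zero, add_zero] at this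
    simpa only [Complex.real_smul, mul_comm] using this
  exact (Lp.eq_zero_iff_ae_eq_zero).2 hg

/-- The graph of `P`. -/
def schrodingerGraph (h : ℝ) (V : SignedMeasure ℝ) : Submodule ℂ (L2 × L2) where
  carrier := {p | IsSchrodingerPair h V p.1 p.2}
  add_mem' := fun H₁ H₂ => H₁.add H₂
  zero_mem' := isSchrodingerPair_zero h V
  smul_mem' := fun a _ H => H.smul a

/-- The unbounded operator `P = -h² ∂ₓ² + V` on `L²(ℝ)`, with domain
`{u ∈ H¹(ℝ) : u' ∈ L^∞(ℝ), P u ∈ L²(ℝ)}`. -/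
def schrodinger (h : ℝ) (V : SignedMeasure ℝ) : L2 →ₗ.[ℂ] L2 :=
  (schrodingerGraph h V).toLinearPMap

theorem mem_schrodinger_graph {h : ℝ} {V : SignedMeasure ℝ} {u g : L2} :
    (u, g) ∈ (schrodinger h V).graph ↔ IsSchrodingerPair h V u g := by
  rw [schrodinger, Submodule.toLinearPMap_graph_eq]
  · rfl
  · rintro ⟨u, g⟩ H hu
    obtain rfl : u = 0 := hu
    exact IsSchrodingerPair.eq_zero H

theorem mem_schrodinger_domain {h : ℝ} {V : SignedMeasure ℝ} {u : L2} :
    u ∈ (schrodinger h V).domain ↔ ∃ g, IsSchrodingerPair h V u g := by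
  simp only [← mem_schrodinger_graph, LinearPMap.mem_domain_iff]

/-- The bounded operator `R` on `L²(ℝ)` is the resolvent `(A - z)⁻¹`: a two-sided inverse of
`A - z : dom A → L²(ℝ)`. There is at most one such `R`. -/
def IsResolvent (A : L2 →ₗ.[ℂ] L2) (z : ℂ) (R : L2 →L[ℂ] L2) : Prop :=
  (∀ f : L2, ∃ hf : R f ∈ A.domain, A ⟨R f, hf⟩ - z • R f = f) ∧
    ∀ u : A.domain, R (A u - z • (u : L2)) = u

/-- `V` is supported in the closed set `K`: its total variation vanishes off `K`. -/
def SupportedIn (V : SignedMeasure ℝ) (K : Set ℝ) : Prop := V.totalVariation Kᶜ = 0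

/-- Multiplication by a bounded function, as a bounded operator on `L²(ℝ)`. -/
def mulOp (m : Lp ℂ ∞ (volume : Measure ℝ)) : L2 →L[ℂ] L2 :=
  (ContinuousLinearMap.mul ℂ ℂ).holderL volume ∞ 2 2 m

theorem mulOp_ae (m : Lp ℂ ∞ (volume : Measure ℝ)) (u : L2) :
    mulOp m u =ᵐ[volume] fun x => m x * u x :=
  (ContinuousLinearMap.mul ℂ ℂ).coeFn_holder m u

/-- The weight `(|x| + 1)^{-(1+δ)/2}`. -/
def weightFun (δ : ℝ) (x : ℝ) : ℂ := (((|x| + 1) ^ (-((1 + δ) / 2)) : ℝ) : ℂ)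

/-- The characteristic function of `{x : |x| > R₀}`. -/
def exteriorFun (R₀ : ℝ) (x : ℝ) : ℂ := Set.indicator {y : ℝ | R₀ < |y|} (fun _ => 1) x

theorem memLp_weightFun {δ : ℝ} (hδ : 0 < δ) : MemLp (weightFun δ) ∞ (volume : Measure ℝ) := by
  refine memLp_top_of_bound ?_ 1 (Filter.Eventually.of_forall fun x => ?_)
  · refine Continuous.aestronglyMeasurable (Complex.continuous_ofReal.comp ?_)
    exact (continuous_abs.add continuous_const).rpow_const
      fun x => Or.inl (by have : (0 : ℝ) < |x| + 1 := by positivity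
                          exact this.ne')
  · have h1 : (1 : ℝ) ≤ |x| + 1 := by linarith [abs_nonneg x]
    rw [weightFun, Complex.norm_real, Real.norm_of_nonneg (by positivity)]
    exact Real.rpow_le_one_of_one_le_of_nonpos h1 (by linarith)

theorem memLp_exteriorFun (R₀ : ℝ) : MemLp (exteriorFun R₀) ∞ (volume : Measure ℝ) := by
  refine (memLp_top_const (1 : ℂ)).indicator ?_
  exact measurableSet_lt measurable_const measurable_norm

/-- Multiplication by `(|x| + 1)^{-(1+δ)/2}` on `L²(ℝ)`. -/
def weightOp (δ : ℝ) (hδ : 0 < δ) : L2 →L[ℂ] L2 := mulOp ((memLp_weightFun hδ).toLp _)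

/-- Multiplication by the characteristic function of `{x : |x| > R₀}` on `L²(ℝ)`. -/
def exteriorOp (R₀ : ℝ) : L2 →L[ℂ] L2 := mulOp ((memLp_exteriorFun R₀).toLp _)

end

/-! Write z = E ± iε as h²k² with Im k > 0, and let (P - z)u = f with f vanishing on [-R₀, R₀].
Three facts give an L¹ → L∞ bound outside the support of V.

Outgoing condition. For |x| > R₀ the equation is -u'' - k²u = f/h². With D = u' - iku, the product
e^{ikx} D has derivative -e^{ikx} f/h² and tends to 0 at +∞, so |D(X)| ≤ ‖f‖₁/h² for X > R₀.
Reflection treats -X. This is `norm_outgoing_le`.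

Flux. In the imaginary part of the pairing of the equation with ū over (-X, X], the real measure V
disappears whatever its size (`IsPointwiseSolution.flux`). After inserting the outgoing condition,
the terms |u(X)|², |u(-X)|² and 2 Im k ∫|u|² all carry the same factor h² Re k, so nothing cancels,
and ‖f‖₁ times values of u outside [-R₀, R₀] bounds their sum
(`IsPointwiseSolution.energy_estimate`).

Absorption. With m the supremum of |u| on |x| > R₀, and since √E ≤ h|Re k|, this reads √E h m² ≤
3‖f‖₁ m. Hence m ≤ 3‖f‖₁/(√E h), uniformly in V and ε (`IsSchrodingerPair.exterior_bound`). For δ >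
0 the weight is square integrable, so Cauchy–Schwarz on both sides turns this into the L² bound.

The resolvent exists because the form of P - z is coercive on H¹ (`isUnit_formOp`): its imaginary
part controls ‖u‖², and its real part then controls ‖u'‖². It is also a left inverse, because the
energy estimate with f = 0 forces u = 0.

As V is a measure, u' may jump at atoms. It is therefore taken right continuous, and integrations by
parts run over half-open intervals and rest on Fubini. -/

noncomputable section

/-! ### Primitives of measures, integration by parts and the du Bois-Reymond lemma. -/

section Primitives

open Set

/-- Integration by parts, one factor being a primitive with respect to an arbitrary measure. -/
theorem integral_Ioc_parts {μ : Measure ℝ} [SFinite μ] {w ψ : ℝ → ℂ} {a b : ℝ}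
    (hw : IntegrableOn w (Ioc a b) μ) (hψ : IntegrableOn ψ (Ioc a b)) :
    IntegrableOn (fun y => ψ y * ∫ x in Ioc a y, w x ∂μ) (Ioc a b) ∧
    (∫ x in Ioc a b, (∫ y in Ioc a x, ψ y) * w x ∂μ) +
        ∫ y in Ioc a b, ψ y * ∫ x in Ioc a y, w x ∂μ =
      (∫ y in Ioc a b, ψ y) * ∫ x in Ioc a b, w x ∂μ := by
  -- Fubini on the triangle x ≤ y. The diagonal is included so that an atom of `μ` at y is counted,
  -- as it is in the integral over (a, y].
  have hT : MeasurableSet {p : ℝ × ℝ | p.1 ≤ p.2} := measurableSet_le measurable_fst measurable_snd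
  have hI : Integrable (fun p : ℝ × ℝ => {p : ℝ × ℝ | p.1 ≤ p.2}.indicator
      (fun p => w p.1 * ψ p.2) p) ((μ.restrict (Ioc a b)).prod (volume.restrict (Ioc a b))) :=
    (hw.mul_prod hψ).indicator hT
  have h1 : ∀ y ∈ Ioc a b, (∫ x in Ioc a b, {p : ℝ × ℝ | p.1 ≤ p.2}.indicator
      (fun p => w p.1 * ψ p.2) (x, y) ∂μ) = ψ y * ∫ x in Ioc a y, w x ∂μ := by
    intro y hy
    rw [← integral_const_mul, ← integral_indicator measurableSet_Ioc,
      ← integral_indicator measurableSet_Ioc]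
    congr 1; ext x
    have h3 := hy.2
    clear hI hw hψ hy
    simp only [indicator, mem_ofPred_eq, mem_Ioc, mul_comm (w x)]
    generalize ψ y * w x = t
    grind
  have h2 : ∀ x ∈ Ioc a b, (∫ y in Ioc a b, {p : ℝ × ℝ | p.1 ≤ p.2}.indicator
      (fun p => w p.1 * ψ p.2) (x, y)) =
        (∫ y in Ioc a b, ψ y) * w x - (∫ y in Ioc a x, ψ y) * w x := by
    intro x hx
    have e1 : (∫ y in Ioc a b, ψ y) = (∫ y in Ioc a x, ψ y) + ∫ y in Ioc x b, ψ y := by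
      rw [← Ioc_union_Ioc_eq_Ioc hx.1.le hx.2, setIntegral_union (Ioc_disjoint_Ioc_of_le le_rfl)
        measurableSet_Ioc (hψ.mono_set (Ioc_subset_Ioc_right hx.2))
        (hψ.mono_set (Ioc_subset_Ioc_left hx.1.le))]
    -- For fixed x the triangle leaves y in [x, b]; the extra endpoint is harmless, this integral
    -- being against Lebesgue measure.
    rw [e1, add_mul, add_sub_cancel_left, ← integral_Icc_eq_integral_Ioc (x := x), mul_comm,
      ← integral_const_mul, ← integral_indicator measurableSet_Ioc,
      ← integral_indicator measurableSet_Icc]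
    congr 1; ext y
    have h3 := hx.1
    clear hI hw hψ hx e1 h1
    simp only [indicator, mem_ofPred_eq, mem_Ioc, mem_Icc]
    generalize w x * ψ y = t
    grind
  have hint := hI.integral_prod_right
  refine ⟨hint.congr ?_, ?_⟩
  · filter_upwards [ae_restrict_mem measurableSet_Ioc] with y hy using h1 y hy
  have hswap := integral_integral_swap (f := fun x y => {p : ℝ × ℝ | p.1 ≤ p.2}.indicator
      (fun p => w p.1 * ψ p.2) (x, y)) hI
  rw [setIntegral_congr_fun measurableSet_Ioc h1] at hswap
  rw [← hswap, setIntegral_congr_fun measurableSet_Ioc h2]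
  have hint2 : IntegrableOn (fun x => (∫ y in Ioc a b, ψ y) * w x
      - (∫ y in Ioc a x, ψ y) * w x) (Ioc a b) μ := by
    refine hI.integral_prod_left.congr ?_
    filter_upwards [ae_restrict_mem measurableSet_Ioc] with x hx using h2 x hx
  have hw' := hw.const_mul (∫ y in Ioc a b, ψ y)
  have hint3 : IntegrableOn (fun x => (∫ y in Ioc a x, ψ y) * w x) (Ioc a b) μ := by
    refine (hw'.sub hint2).congr (Filter.Eventually.of_forall fun x => ?_)
    simp
  rw [integral_sub hw' hint3, integral_const_mul]
  ring

/-- `F` is a primitive of the measure `w μ`, up to an additive constant. -/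
def IsPrimitive (μ : Measure ℝ) (w F : ℝ → ℂ) : Prop :=
  ∀ a b, a ≤ b → F b - F a = ∫ x in Ioc a b, w x ∂μ

theorem exists_isPrimitive {μ : Measure ℝ} {w : ℝ → ℂ} (hw : LocallyIntegrable w μ) :
    ∃ F, IsPrimitive μ w F := by
  have hi : ∀ a b : ℝ, IntervalIntegrable w μ a b := fun a b =>
    ⟨(hw.integrableOn_isCompact isCompact_Icc).mono_set Ioc_subset_Icc_self,
      (hw.integrableOn_isCompact isCompact_Icc).mono_set Ioc_subset_Icc_self⟩
  refine ⟨fun x => ∫ t in (0 : ℝ)..x, w t ∂μ, fun a b hab => ?_⟩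
  rw [intervalIntegral.integral_interval_sub_left (hi _ _) (hi _ _),
    intervalIntegral.integral_of_le hab]

theorem MeasureTheory.LocallyIntegrable.integrableOn_Ioc {μ : Measure ℝ} {w : ℝ → ℂ}
    (hw : LocallyIntegrable w μ) (a b : ℝ) : IntegrableOn w (Ioc a b) μ :=
  (hw.integrableOn_isCompact isCompact_Icc).mono_set Ioc_subset_Icc_self

/-- Up to the constant `F a`, the function is an integral over (a, y], whose integrability in y is
the Fubini half of `integral_Ioc_parts` with ψ = 1. -/
theorem IsPrimitive.locallyIntegrable {μ : Measure ℝ} [SFinite μ] {w F : ℝ → ℂ}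
    (hF : IsPrimitive μ w F) (hw : LocallyIntegrable w μ) : LocallyIntegrable F := by
  have h : ∀ a b, IntegrableOn F (Ioc a b) := by
    intro a b
    have h1 := (integral_Ioc_parts (ψ := fun _ => 1) (hw.integrableOn_Ioc a b)
      (by simp)).1
    have h2 : IntegrableOn (fun _ : ℝ => F a) (Ioc a b) := by simp
    refine (h1.add h2).congr ?_
    filter_upwards [ae_restrict_mem measurableSet_Ioc] with y hy
    simp [← hF a y hy.1.le]
  intro x
  refine ⟨Ioc (x - 1) (x + 1), Filter.mem_of_superset (Ioo_mem_nhds (by linarith) (by linarith))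
    Ioo_subset_Ioc_self, h _ _⟩

/-- Integration by parts on `(a, b]`, with local hypotheses. -/
theorem integral_Ioc_parts_of_primitive {μ : Measure ℝ} [SFinite μ] {w ψ F Ψ : ℝ → ℂ} {a b : ℝ}
    (hab : a ≤ b) (hw : IntegrableOn w (Ioc a b) μ) (hψ : IntegrableOn ψ (Ioc a b))
    (hF : ∀ x ∈ Icc a b, F x - F a = ∫ y in Ioc a x, w y ∂μ)
    (hΨ : ∀ x ∈ Icc a b, Ψ x - Ψ a = ∫ y in Ioc a x, ψ y)
    (hΨw : IntegrableOn (fun x => Ψ x * w x) (Ioc a b) μ) :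
    (∫ x in Ioc a b, Ψ x * w x ∂μ) + ∫ y in Ioc a b, ψ y * F y = Ψ b * F b - Ψ a * F a := by
  obtain ⟨h1, h2⟩ := integral_Ioc_parts hw hψ
  have hb : b ∈ Icc a b := right_mem_Icc.2 hab
  have e1 : (∫ x in Ioc a b, (∫ y in Ioc a x, ψ y) * w x ∂μ) =
      (∫ x in Ioc a b, Ψ x * w x ∂μ) - Ψ a * ∫ x in Ioc a b, w x ∂μ := by
    rw [← integral_const_mul, ← integral_sub hΨw (hw.const_mul _)]
    refine setIntegral_congr_fun measurableSet_Ioc fun x hx => ?_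
    simp only [← hΨ x (Ioc_subset_Icc_self hx)]
    ring
  have e2 : (∫ y in Ioc a b, ψ y * F y) =
      (∫ y in Ioc a b, ψ y * ∫ x in Ioc a y, w x ∂μ) + (∫ y in Ioc a b, ψ y) * F a := by
    rw [← integral_mul_const, ← integral_add h1 (hψ.mul_const _)]
    refine setIntegral_congr_fun measurableSet_Ioc fun x hx => ?_
    simp only [← hF x (Ioc_subset_Icc_self hx)]
    ring
  rw [e1, ← hF b hb, ← hΨ b hb] at h2
  rw [e2, ← hΨ b hb]
  linear_combination h2

theorem IsTest.isPrimitive {φ : ℝ → ℂ} (hφ : IsTest φ) : IsPrimitive volume (_root_.deriv φ) φ := by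
  intro a b hab
  rw [← intervalIntegral.integral_of_le hab, intervalIntegral.integral_deriv_eq_sub
    (fun x _ => hφ.1.differentiable (by simp) x)
    (hφ.deriv.1.continuous.intervalIntegrable _ _)]

theorem exists_Ioc_of_hasCompactSupport {φ : ℝ → ℂ} (hφ : HasCompactSupport φ) :
    ∃ a b : ℝ, a ≤ b ∧ φ a = 0 ∧ φ b = 0 ∧ ∀ x ∉ Ioc a b, φ x = 0 := by
  obtain ⟨r, hr⟩ := hφ.isBounded.subset_closedBall 0
  have key : ∀ x, |r| < |x| → φ x = 0 := fun x hx => by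
    by_contra hne
    have := hr (subset_tsupport _ (Function.mem_support.2 hne))
    rw [mem_closedBall_zero_iff, Real.norm_eq_abs] at this
    linarith [le_abs_self r]
  refine ⟨-(|r| + 1), |r| + 1, by linarith [abs_nonneg r], key _ ?_, key _ ?_, fun x hx => key _ ?_⟩
  · rw [abs_neg, abs_of_pos (show 0 < |r| + 1 by positivity)]; linarith
  · rw [abs_of_pos (show 0 < |r| + 1 by positivity)]; linarith
  · by_contra hle
    obtain ⟨h1, h2⟩ := abs_le.1 (not_lt.1 hle)
    exact hx ⟨by linarith, by linarith⟩

/-- The link between pointwise and distributional statements: the distributional derivative of a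
primitive is the measure `w μ`, atoms included. -/
theorem IsPrimitive.integral_test {μ : Measure ℝ} [SFinite μ] {w F φ : ℝ → ℂ}
    (hF : IsPrimitive μ w F) (hw : LocallyIntegrable w μ) (hφ : IsTest φ) :
    ∫ x, F x * deriv φ x = -∫ x, w x * φ x ∂μ := by
  obtain ⟨a, b, hab, ha, hb, hs⟩ := exists_Ioc_of_hasCompactSupport hφ.2
  obtain ⟨C, hC⟩ := hφ.1.continuous.bounded_above_of_compact_support hφ.2
  have hz : ∀ x ∉ Icc a b, φ x = 0 := fun x hx => hs x fun h => hx (Ioc_subset_Icc_self h)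
  have hd : ∀ x ∉ Icc a b, deriv φ x = 0 := fun x hx => by
    have : φ =ᶠ[nhds x] fun _ => 0 := by
      filter_upwards [isClosed_Icc.isOpen_compl.mem_nhds hx] with y hy using hz y hy
    rw [this.deriv_eq]; simp
  have key := integral_Ioc_parts_of_primitive hab (hw.integrableOn_Ioc a b)
    ((hφ.deriv.1.continuous.locallyIntegrable).integrableOn_Ioc a b)
    (fun x hx => hF a x hx.1) (fun x hx => hφ.isPrimitive a x hx.1)
    ((hw.integrableOn_Ioc a b).bdd_mul hφ.1.continuous.aestronglyMeasurable
      (Filter.Eventually.of_forall hC))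
  rw [ha, hb, setIntegral_eq_integral_of_forall_compl_eq_zero (fun x hx => by simp [hs x hx]),
    ← integral_Icc_eq_integral_Ioc,
    setIntegral_eq_integral_of_forall_compl_eq_zero (fun x hx => by simp [hd x hx])] at key
  simp only [mul_comm (F _), mul_comm (w _)]
  linear_combination key

theorem exists_isTest_integral_eq_one : ∃ χ : ℝ → ℂ, IsTest χ ∧ ∫ x, χ x = 1 := by
  let f : ContDiffBump (0 : ℝ) := ⟨1, 2, one_pos, one_lt_two⟩
  refine ⟨fun x => (f.normed volume x : ℂ), ⟨Complex.ofRealCLM.contDiff.comp f.contDiff_normed,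
    f.hasCompactSupport_normed.comp_left (g := ((↑) : ℝ → ℂ)) Complex.ofReal_zero⟩, ?_⟩
  rw [integral_complex_ofReal, f.integral_normed]; simp

theorem IsTest.integrable {φ : ℝ → ℂ} (hφ : IsTest φ) : Integrable φ :=
  hφ.1.continuous.integrable_of_hasCompactSupport hφ.2

theorem IsTest.integrable_mul_locallyIntegrable {φ : ℝ → ℂ} (hφ : IsTest φ) {μ : Measure ℝ}
    {W : ℝ → ℂ} (hW : LocallyIntegrable W μ) : Integrable (fun x => W x * φ x) μ := by
  simpa only [smul_eq_mul, mul_comm] using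
    hW.integrable_smul_left_of_hasCompactSupport hφ.1.continuous hφ.2

theorem IsTest.add {φ ψ : ℝ → ℂ} (hφ : IsTest φ) (hψ : IsTest ψ) :
    IsTest (fun x => φ x + ψ x) := ⟨hφ.1.add hψ.1, hφ.2.add hψ.2⟩

theorem IsTest.const_mul {φ : ℝ → ℂ} (hφ : IsTest φ) (a : ℂ) : IsTest (fun x => a * φ x) :=
  ⟨contDiff_const.mul hφ.1, hφ.2.mul_left⟩

/-- A test function with vanishing integral is the derivative of a test function. -/
theorem IsTest.exists_deriv_eq {φ : ℝ → ℂ} (hφ : IsTest φ) (h0 : ∫ x, φ x = 0) :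
    ∃ Φ, IsTest Φ ∧ _root_.deriv Φ = φ := by
  obtain ⟨a, b, hab, -, -, hs⟩ := exists_Ioc_of_hasCompactSupport hφ.2
  have hc := hφ.1.continuous
  have hd : ∀ x, HasDerivAt (fun x => ∫ t in a..x, φ t) (φ x) x := fun x =>
    intervalIntegral.integral_hasDerivAt_right (hc.intervalIntegrable _ _)
      hc.stronglyMeasurable.stronglyMeasurableAtFilter hc.continuousAt
  have hderiv : _root_.deriv (fun x => ∫ t in a..x, φ t) = φ := funext fun x => (hd x).deriv
  refine ⟨fun x => ∫ t in a..x, φ t, ⟨?_, ?_⟩, hderiv⟩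
  · rw [contDiff_infty_iff_deriv, hderiv]
    exact ⟨fun x => (hd x).differentiableAt, hφ.1⟩
  · refine HasCompactSupport.intro (isCompact_Icc (a := a) (b := b)) fun x hx => ?_
    rcases lt_or_ge x a with h | h
    · rw [intervalIntegral.integral_symm, intervalIntegral.integral_of_le h.le,
        setIntegral_eq_zero_of_forall_eq_zero, neg_zero]
      exact fun t ht => hs t fun h' => by linarith [ht.2, h'.1]
    · have hb : b < x := by
        by_contra hb
        exact hx ⟨h, not_lt.1 hb⟩
      rw [intervalIntegral.integral_of_le h,
        setIntegral_eq_integral_of_forall_compl_eq_zero, h0]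
      exact fun t ht => hs t fun h' => ht ⟨h'.1, h'.2.trans hb.le⟩

/-- The lemma of du Bois-Reymond: a distribution with zero derivative is constant. -/
theorem ae_eq_const_of_integral_mul_deriv_eq_zero {W : ℝ → ℂ} (hW : LocallyIntegrable W)
    (h : ∀ φ, IsTest φ → ∫ x, W x * deriv φ x = 0) : ∃ κ : ℂ, ∀ᵐ x, W x = κ := by
  obtain ⟨χ, hχ, hχ1⟩ := exists_isTest_integral_eq_one
  refine ⟨∫ x, W x * χ x, ae_eq_of_integral_contDiff_smul_eq hW
    (continuous_const.locallyIntegrable) fun ρ hρ hs => ?_⟩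
  have ht : IsTest (fun x => (ρ x : ℂ)) :=
    ⟨Complex.ofRealCLM.contDiff.comp hρ, hs.comp_left (g := ((↑) : ℝ → ℂ)) Complex.ofReal_zero⟩
  -- Subtracting (∫ρ)χ leaves a test function of mean zero, hence a derivative of a test function,
  -- on which `W` vanishes by hypothesis.
  have ht' := hχ.const_mul (-∫ x, (ρ x : ℂ))
  obtain ⟨Φ, hΦ, hd⟩ := (ht.add ht').exists_deriv_eq (by
    rw [integral_add ht.integrable ht'.integrable, integral_const_mul, hχ1]; ring)
  have := h Φ hΦ
  rw [hd] at this
  simp only [mul_add] at this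
  rw [integral_add (ht.integrable_mul_locallyIntegrable hW)
    (ht'.integrable_mul_locallyIntegrable hW)] at this
  simp only [mul_left_comm (W _), integral_const_mul] at this
  simp only [Complex.real_smul, integral_mul_const]
  simp only [mul_comm (W _) (ρ _ : ℂ)] at this
  linear_combination this

end Primitives

/-! ### Pointwise representatives of u and u', and their boundedness. -/

section Representatives

open Set

/-- Special to measures without atoms; primitives with respect to `V` jump. -/
theorem IsPrimitive.continuous {w F : ℝ → ℂ} (hF : IsPrimitive volume w F)
    (hw : LocallyIntegrable w) : Continuous F := by
  have hi : ∀ a b : ℝ, IntervalIntegrable w volume a b := fun a b =>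
    ⟨hw.integrableOn_Ioc a b, hw.integrableOn_Ioc b a⟩
  have : F = fun x => F 0 + ∫ t in (0 : ℝ)..x, w t := by
    ext x
    rcases le_total 0 x with hx | hx
    · rw [intervalIntegral.integral_of_le hx, ← hF 0 x hx]; ring
    · rw [intervalIntegral.integral_symm, intervalIntegral.integral_of_le hx, ← hF x 0 hx]; ring
  rw [this]
  exact continuous_const.add (intervalIntegral.continuous_primitive hi 0)

theorem IsPrimitive.congr_ae {μ : Measure ℝ} {w w' F : ℝ → ℂ} (hF : IsPrimitive μ w F)
    (h : w =ᵐ[μ] w') : IsPrimitive μ w' F := fun a b hab =>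
  (hF a b hab).trans (integral_congr_ae (ae_restrict_of_ae h))

theorem L2.locallyIntegrable (u : L2) : LocallyIntegrable u :=
  (Lp.memLp u).locallyIntegrable (by norm_num)

theorem L2.integrable_norm_sq (u : L2) : Integrable (fun x => ‖u x‖ ^ 2) :=
  (memLp_two_iff_integrable_sq_norm (Lp.aestronglyMeasurable u)).1 (Lp.memLp u)

theorem L2.norm_sq_eq_integral (u : L2) : ‖u‖ ^ 2 = ∫ x, ‖u x‖ ^ 2 := by
  have h := inner_self_eq_norm_sq_to_K (𝕜 := ℂ) u
  rw [MeasureTheory.L2.inner_def] at h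
  simp only [inner_self_eq_norm_sq_to_K] at h
  have h2 : (∫ x, ((‖u x‖ : ℂ)) ^ 2) = ((∫ x, ‖u x‖ ^ 2 : ℝ) : ℂ) := by
    rw [← integral_complex_ofReal]; simp
  simp only [Complex.coe_algebraMap] at h
  rw [h2] at h
  exact_mod_cast h.symm

theorem L2.norm_setIntegral_Ioc_le (u : L2) {a b : ℝ} (hab : a ≤ b) :
    ‖∫ x in Ioc a b, u x‖ ≤ √(b - a) * ‖u‖ := by
  have hfin : volume (Ioc a b) ≠ ⊤ := by simp
  rw [← L2.inner_indicatorConstLp_one (𝕜 := ℂ) measurableSet_Ioc hfin u]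
  refine (norm_inner_le_norm _ _).trans ?_
  rw [norm_indicatorConstLp (by norm_num) (by norm_num)]
  simp [Measure.real, Real.sqrt_eq_rpow, hab]

/-- If `f` oscillates by at most `K` to the right of `x` on an interval of length `l`, then `f x` is
controlled by the `L²` norm. -/
theorem norm_le_of_oscillation {u : L2} {f : ℝ → ℂ} (hf : u =ᵐ[volume] f) {x l K : ℝ} (hl : 0 < l)
    (hK : ∀ y ∈ Ioc x (x + l), ‖f x‖ ≤ ‖f y‖ + K) : ‖f x‖ ≤ ‖u‖ / √l + K := by
  rcases le_total (‖f x‖ - K) 0 with h0 | h0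
  · have : 0 ≤ ‖u‖ / √l := by positivity
    linarith
  have h1 : l * (‖f x‖ - K) ^ 2 ≤ ‖u‖ ^ 2 := by
    rw [L2.norm_sq_eq_integral]
    have hint := L2.integrable_norm_sq u
    calc l * (‖f x‖ - K) ^ 2 = ∫ y in Ioc x (x + l), (‖f x‖ - K) ^ 2 := by
          simp [hl.le]
      _ ≤ ∫ y in Ioc x (x + l), ‖u y‖ ^ 2 := by
          refine setIntegral_mono_on_ae (by simp) hint.integrableOn measurableSet_Ioc ?_
          filter_upwards [hf] with y hy hmem
          rw [hy]
          have := hK y hmem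
          gcongr
          linarith
      _ ≤ ∫ y, ‖u y‖ ^ 2 := setIntegral_le_integral hint
          (Filter.Eventually.of_forall fun y => by positivity)
  have h2 : √l * (‖f x‖ - K) ≤ ‖u‖ := by
    refine abs_le_of_sq_le_sq' ?_ (norm_nonneg u) |>.2
    rwa [mul_pow, Real.sq_sqrt hl.le]
  have h3 : ‖f x‖ - K ≤ ‖u‖ / √l := by
    rw [le_div_iff₀ (Real.sqrt_pos.2 hl)]; linarith
  linarith

/-- An element of `H¹(ℝ)` has a continuous representative, a primitive of the weak derivative. -/
theorem HasWeakDeriv.exists_contRep {u v : L2} (h : HasWeakDeriv u v) :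
    ∃ c, IsContRep u c ∧ IsPrimitive volume v c := by
  have hv := L2.locallyIntegrable v
  have hu := L2.locallyIntegrable u
  obtain ⟨G, hG⟩ := exists_isPrimitive hv
  have hGl := hG.locallyIntegrable hv
  obtain ⟨κ, hκ⟩ := ae_eq_const_of_integral_mul_deriv_eq_zero (hu.sub hGl) fun φ hφ => by
    simp only [Pi.sub_apply, sub_mul]
    rw [integral_sub (hφ.deriv.integrable_mul_locallyIntegrable hu)
      (hφ.deriv.integrable_mul_locallyIntegrable hGl), h φ hφ, hG.integral_test hv hφ, sub_self]
  refine ⟨fun x => G x + κ, ⟨(hG.continuous hv).add continuous_const, ?_⟩, fun a b hab => ?_⟩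
  · filter_upwards [hκ] with x hx
    rw [← hx]; simp
  · rw [← hG a b hab]; ring

theorem IsContRep.unique {u : L2} {c c' : ℝ → ℂ} (h : IsContRep u c) (h' : IsContRep u c') :
    c = c' :=
  (h.1.ae_eq_iff_eq (μ := volume) h'.1).1 (h.2.symm.trans h'.2)

/-- The one-dimensional Sobolev inequality. -/
theorem IsContRep.norm_le {u v : L2} {c : ℝ → ℂ} (hc : IsContRep u c)
    (hp : IsPrimitive volume v c) {l : ℝ} (hl : 0 < l) (x : ℝ) :
    ‖c x‖ ≤ ‖u‖ / √l + √l * ‖v‖ := by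
  refine norm_le_of_oscillation hc.2 hl fun y hy => ?_
  have h1 := L2.norm_setIntegral_Ioc_le v hy.1.le
  rw [← hp x y hy.1.le] at h1
  have h2 : √(y - x) ≤ √l := Real.sqrt_le_sqrt (by linarith [hy.2])
  have h3 : √(y - x) * ‖v‖ ≤ √l * ‖v‖ := by gcongr
  have h4 : ‖c x‖ ≤ ‖c y‖ + ‖c y - c x‖ := by
    simpa using norm_sub_le (c y) (c y - c x)
  linarith

/-- `c` and `v` are the pointwise representatives of `u` and `u'`, where `-h² u'' + u V = g`; here
`v` is normalised to be right continuous. -/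
structure IsPointwiseSolution (h : ℝ) (V : SignedMeasure ℝ) (c v g : ℝ → ℂ) : Prop where
  prim : IsPrimitive volume v c
  jump : ∀ a b, a ≤ b → (h : ℂ) ^ 2 * (v b - v a) =
    (∫ x in Ioc a b, c x ∂V.toJordanDecomposition.posPart)
      - (∫ x in Ioc a b, c x ∂V.toJordanDecomposition.negPart) - ∫ x in Ioc a b, g x

/-- The equation says that h²v + G - p + n has zero distributional derivative, where p, n, G are
primitives of c against the two parts of V and of g. So it is a.e. a constant, and solving for v
defines the representative at every point. -/
theorem SchrodingerEq.exists_pointwiseSolution {h : ℝ} (hh : h ≠ 0) {V : SignedMeasure ℝ}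
    {u v g : L2} {c : ℝ → ℂ} (hv : HasWeakDeriv u v) (hc : IsContRep u c)
    (hS : SchrodingerEq h V u c g) :
    ∃ v', v =ᵐ[volume] v' ∧ IsPointwiseSolution h V c v' g := by
  have hcl : ∀ (μ : Measure ℝ) [IsFiniteMeasure μ], LocallyIntegrable c μ := fun μ _ =>
    hc.1.locallyIntegrable
  have hvl := L2.locallyIntegrable v
  have hgl := L2.locallyIntegrable g
  obtain ⟨p, hp⟩ := exists_isPrimitive (hcl V.toJordanDecomposition.posPart)
  obtain ⟨n, hn⟩ := exists_isPrimitive (hcl V.toJordanDecomposition.negPart)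
  obtain ⟨G, hG⟩ := exists_isPrimitive hgl
  have hpl := hp.locallyIntegrable (hcl _)
  have hnl := hn.locallyIntegrable (hcl _)
  have hGl := hG.locallyIntegrable hgl
  have hhC : (h : ℂ) ≠ 0 := by simpa using hh
  have hvl' : LocallyIntegrable (fun x => (h : ℂ) ^ 2 * v x) := by
    simpa [Pi.smul_def] using hvl.smul ((h : ℂ) ^ 2)
  obtain ⟨κ, hκ⟩ := ae_eq_const_of_integral_mul_deriv_eq_zero
      (((hvl'.add hGl).sub hpl).add hnl) fun φ hφ => by
    have hd := hφ.deriv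
    have i1 := hd.integrable_mul_locallyIntegrable hvl'
    have i2 := hd.integrable_mul_locallyIntegrable hGl
    have i3 := hd.integrable_mul_locallyIntegrable hpl
    have i4 := hd.integrable_mul_locallyIntegrable hnl
    simp only [Pi.add_apply, Pi.sub_apply, sub_mul, add_mul]
    rw [integral_add ?_ i4, integral_sub ?_ i3, integral_add i1 i2, hp.integral_test (hcl _) hφ,
      hn.integral_test (hcl _) hφ, hG.integral_test hgl hφ]
    · have h1 := hS φ hφ
      have h2 := hv _ hd
      simp only [iteratedDeriv_succ, iteratedDeriv_zero, signedIntegral] at h1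
      simp only [mul_assoc, integral_const_mul]
      rw [h2] at h1
      linear_combination -h1
    · exact i1.add i2
    · exact (i1.add i2).sub i3
  have hae : v =ᵐ[volume] fun x => ((h : ℂ) ^ 2)⁻¹ * (κ - G x + p x - n x) := by
    filter_upwards [hκ] with x hx
    simp only [Pi.add_apply, Pi.sub_apply] at hx
    field_simp
    linear_combination hx
  obtain ⟨c', hc', hcp⟩ := hv.exists_contRep
  rw [hc'.unique hc] at hcp
  refine ⟨_, hae, hcp.congr_ae hae, fun a b hab => ?_⟩
  rw [← hp a b hab, ← hn a b hab, ← hG a b hab]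
  field_simp
  ring

theorem IsPointwiseSolution.norm_sub_le {h : ℝ} {V : SignedMeasure ℝ} {g : L2} {c v : ℝ → ℂ}
    (hs : IsPointwiseSolution h V c v g) {K : ℝ} (hK : ∀ x, ‖c x‖ ≤ K) {a b : ℝ} (hab : a ≤ b) :
    h ^ 2 * ‖v b - v a‖ ≤ K * V.toJordanDecomposition.posPart.real univ
      + K * V.toJordanDecomposition.negPart.real univ + √(b - a) * ‖g‖ := by
  have hK0 : 0 ≤ K := (norm_nonneg _).trans (hK 0)
  have key : ∀ (μ : Measure ℝ) [IsFiniteMeasure μ], ‖∫ x in Ioc a b, c x ∂μ‖ ≤ K * μ.real univ := by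
    intro μ _
    refine (norm_setIntegral_le_of_norm_le_const (measure_lt_top _ _) fun x _ => hK x).trans ?_
    gcongr
    · simp
    · exact subset_univ _
  have := congrArg norm (hs.jump a b hab)
  rw [norm_mul, norm_pow, Complex.norm_real, Real.norm_eq_abs, sq_abs] at this
  rw [this]
  refine (norm_sub_le_of_le (norm_sub_le_of_le (key _) (key _))
    (L2.norm_setIntegral_Ioc_le g hab))

/-- The finite mass of V and Cauchy–Schwarz for g bound the oscillation of the derivative on unit
intervals, and its L² norm then bounds its size. The bound is only qualitative: it removes the
boundary term at infinity and makes suprema finite, and does not enter the final constant. -/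
theorem IsPointwiseSolution.exists_bound {h : ℝ} (hh : 0 < h) {V : SignedMeasure ℝ} {u v g : L2}
    {c v' : ℝ → ℂ} (hc : IsContRep u c) (hv : v =ᵐ[volume] v')
    (hs : IsPointwiseSolution h V c v' g) :
    ∃ K, ∀ x, ‖c x‖ ≤ K ∧ ‖v' x‖ ≤ K := by
  have h1 : ∀ x, ‖c x‖ ≤ ‖u‖ / √1 + √1 * ‖v‖ :=
    hc.norm_le (hs.prim.congr_ae hv.symm) one_pos
  set K := ‖u‖ / √1 + √1 * ‖v‖
  set L := (K * V.toJordanDecomposition.posPart.real univ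
      + K * V.toJordanDecomposition.negPart.real univ + ‖g‖) / h ^ 2 with hL
  refine ⟨max K (‖v‖ / √1 + L), fun x => ⟨(h1 x).trans (le_max_left _ _),
    (norm_le_of_oscillation hv one_pos fun y hy => ?_).trans (le_max_right _ _)⟩⟩
  have h2 := hs.norm_sub_le h1 hy.1.le
  have h3 : √(y - x) ≤ 1 := Real.sqrt_le_one.2 (by linarith [hy.2])
  have h4 : √(y - x) * ‖g‖ ≤ 1 * ‖g‖ := by gcongr
  have h5 : ‖v' y - v' x‖ ≤ L := by
    rw [hL, le_div_iff₀ (by positivity)]; linarith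
  have h6 : ‖v' x‖ ≤ ‖v' y‖ + ‖v' y - v' x‖ := by
    simpa using _root_.norm_sub_le (v' y) (v' y - v' x)
  linarith

end Representatives

/-! ### Flux identity, outgoing condition and energy estimate. -/

section ExteriorEstimate

open Set Filter
open scoped ComplexConjugate

theorem im_integral_conj_mul_self {μ : Measure ℝ} (f : ℝ → ℂ) :
    (∫ x, conj (f x) * f x ∂μ).im = 0 := by
  have : (∫ x, conj (f x) * f x ∂μ) = ((∫ x, ‖f x‖ ^ 2 ∂μ : ℝ) : ℂ) := by
    rw [← integral_complex_ofReal]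
    simp [Complex.conj_mul']
  rw [this, Complex.ofReal_im]

theorem MeasureTheory.LocallyIntegrable.conj {μ : Measure ℝ} {f : ℝ → ℂ}
    (hf : LocallyIntegrable f μ) : LocallyIntegrable (fun x => conj (f x)) μ := fun x => by
  obtain ⟨s, hs, hi⟩ := hf x
  refine ⟨s, hs, ?_⟩
  exact Complex.conjLIE.integrable_comp_iff.2 hi

/-- The flux identity. The real measure `V` does not contribute. -/
theorem IsPointwiseSolution.flux {h : ℝ} {V : SignedMeasure ℝ} {c v g : ℝ → ℂ}
    (hs : IsPointwiseSolution h V c v g) (hc : Continuous c) (hv : LocallyIntegrable v)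
    (hg : LocallyIntegrable g) {a b : ℝ} (hab : a ≤ b) :
    h ^ 2 * (conj (c b) * v b - conj (c a) * v a).im = -(∫ x in Ioc a b, conj (c x) * g x).im := by
  have hcc : Continuous fun x => conj (c x) := Complex.continuous_conj.comp hc
  have hvc : IntegrableOn (fun x => conj (v x)) (Ioc a b) := hv.conj.integrableOn_Ioc a b
  have parts : ∀ (μ : Measure ℝ) [SFinite μ] (w : ℝ → ℂ), LocallyIntegrable w μ →
      IntegrableOn (fun y => conj (v y) * ∫ x in Ioc a y, w x ∂μ) (Ioc a b) ∧
      (∫ x in Ioc a b, conj (c x) * w x ∂μ) +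
        ∫ y in Ioc a b, conj (v y) * (∫ x in Ioc a y, w x ∂μ) =
          conj (c b) * ∫ x in Ioc a b, w x ∂μ := by
    intro μ _ w hw
    have hwi := hw.integrableOn_Ioc a b
    refine ⟨(integral_Ioc_parts hwi hvc).1, ?_⟩
    have := integral_Ioc_parts_of_primitive (F := fun y => ∫ x in Ioc a y, w x ∂μ)
      (Ψ := fun x => conj (c x)) hab hwi hvc (fun x _ => by simp) (fun x hx => by
        rw [← map_sub, hs.prim a x hx.1, integral_conj]) ?_
    · simpa using this
    · obtain ⟨K, hK⟩ := isCompact_Icc.exists_bound_of_continuousOn (hcc.continuousOn (s := Icc a b))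
      refine hwi.bdd_mul (c := K) hcc.aestronglyMeasurable ?_
      filter_upwards [ae_restrict_mem measurableSet_Ioc] with x hx
        using hK x (Ioc_subset_Icc_self hx)
  obtain ⟨i1, e1⟩ := parts V.toJordanDecomposition.posPart c hc.locallyIntegrable
  obtain ⟨i2, e2⟩ := parts V.toJordanDecomposition.negPart c hc.locallyIntegrable
  obtain ⟨i3, e3⟩ := parts volume g hg
  -- One factor h²v is replaced by its expression from `jump`, so no product rule for the possibly
  -- discontinuous v is needed; the resulting double integrals cancel against those in `parts`.
  have e4 : (h : ℂ) ^ 2 * (∫ x in Ioc a b, conj (v x) * v x) =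
      (h : ℂ) ^ 2 * v a * (conj (c b) - conj (c a)) +
      (((∫ y in Ioc a b, conj (v y) * ∫ x in Ioc a y, c x ∂V.toJordanDecomposition.posPart)
        - ∫ y in Ioc a b, conj (v y) * ∫ x in Ioc a y, c x ∂V.toJordanDecomposition.negPart)
        - ∫ y in Ioc a b, conj (v y) * ∫ x in Ioc a y, g x) := by
    have i12 : IntegrableOn (fun y =>
        (conj (v y) * ∫ x in Ioc a y, c x ∂V.toJordanDecomposition.posPart)
          - conj (v y) * ∫ x in Ioc a y, c x ∂V.toJordanDecomposition.negPart) (Ioc a b) :=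
      i1.sub i2
    rw [← map_sub, hs.prim a b hab, ← integral_conj, ← integral_const_mul, ← integral_const_mul,
      ← integral_sub i1 i2, ← integral_sub i12 i3]
    refine Eq.trans ?_ (integral_add (hvc.const_mul _) (i12.sub i3))
    refine setIntegral_congr_fun measurableSet_Ioc fun x hx => ?_
    have := hs.jump a x hx.1.le
    linear_combination conj (v x) * this
  -- On the right, the integrals of |v|² and of |c|² against both parts of V are real; only the g
  -- term has an imaginary part to contribute.
  have e5 : (h : ℂ) ^ 2 * (conj (c b) * v b - conj (c a) * v a) =
      (h : ℂ) ^ 2 * (∫ x in Ioc a b, conj (v x) * v x) +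
      ((∫ x in Ioc a b, conj (c x) * c x ∂V.toJordanDecomposition.posPart)
      - (∫ x in Ioc a b, conj (c x) * c x ∂V.toJordanDecomposition.negPart)
      - ∫ x in Ioc a b, conj (c x) * g x) := by
    rw [e4]
    linear_combination conj (c b) * hs.jump a b hab - e1 + e2 + e3
  have := congrArg Complex.im e5
  rw [← Complex.ofReal_pow] at this
  simp only [Complex.im_ofReal_mul, Complex.add_im, Complex.sub_im, im_integral_conj_mul_self]
    at this
  rw [Complex.sub_im, this]
  ring

/-- A bounded solution of `-p'' - k² p = f` on a half-line is outgoing up to an error controlled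
by `f`. -/
theorem norm_outgoing_le {k : ℂ} (hk : 0 < k.im) {p q f : ℝ → ℂ} {X K : ℝ} (hp : Continuous p)
    (hqi : LocallyIntegrable q) (hf : Integrable f)
    (hpq : ∀ x, X ≤ x → p x - p X = ∫ y in Ioc X x, q y)
    (hqf : ∀ x, X ≤ x → q x - q X = ∫ y in Ioc X x, (-k ^ 2 * p y - f y))
    (hpK : ∀ x, ‖p x‖ ≤ K) (hqK : ∀ x, ‖q x‖ ≤ K) :
    ‖q X - Complex.I * k * p X‖ ≤ ∫ x, ‖f x‖ := by
  set e : ℝ → ℂ := fun x => Complex.exp (Complex.I * k * x) with he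
  have hed : ∀ x : ℝ, HasDerivAt e (Complex.I * k * e x) x := by
    intro x
    have h1 : HasDerivAt (fun x : ℝ => Complex.I * k * (x : ℂ)) (Complex.I * k) x := by
      simpa using (Complex.ofRealCLM.hasDerivAt (x := x)).const_mul (Complex.I * k)
    simpa [he, mul_comm] using h1.cexp
  have hec : Continuous e := continuous_iff_continuousAt.2 fun x => (hed x).continuousAt
  have hen : ∀ x : ℝ, ‖e x‖ = Real.exp (-k.im * x) := by
    intro x
    simp [he, Complex.norm_exp]
  have hpc : ∀ x, IntegrableOn p (Ioc X x) := hp.locallyIntegrable.integrableOn_Ioc X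
  have hqc : ∀ x, IntegrableOn q (Ioc X x) := hqi.integrableOn_Ioc X
  have hK0 : 0 ≤ K := (norm_nonneg _).trans (hpK 0)
  -- The factorisation of the operator gives D' = -ikD - f, with integrating factor `e`, whose
  -- modulus exp(-Im k · x) decays.
  set D : ℝ → ℂ := fun x => q x - Complex.I * k * p x with hD
  have hDK : ∀ x, ‖D x‖ ≤ K + ‖k‖ * K := fun x => by
    refine norm_sub_le_of_le (hqK x) ?_
    rw [norm_mul, norm_mul, Complex.norm_I, one_mul]
    gcongr
    exact hpK x
  have key : ∀ x, X ≤ x → e x * D x - e X * D X = -∫ y in Ioc X x, e y * f y := by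
    intro x hx
    have hw : IntegrableOn (fun y => -(Complex.I * k) * D y - f y) (Ioc X x) :=
      (((hqc x).sub ((hpc x).const_mul _)).const_mul _).sub hf.integrableOn
    have hbd : ∀ᵐ y ∂volume.restrict (Ioc X x), ‖e y‖ ≤ Real.exp (-k.im * X) := by
      filter_upwards [ae_restrict_mem measurableSet_Ioc] with y hy
      rw [hen]
      have := hy.1.le
      exact Real.exp_le_exp.2 (by nlinarith)
    have hew := hw.bdd_mul hec.aestronglyMeasurable hbd
    have h1 := integral_Ioc_parts_of_primitive (F := D) (Ψ := e)
      (ψ := fun y => Complex.I * k * e y) hx hw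
      ((continuous_const.mul hec).locallyIntegrable.integrableOn_Ioc X x)
      (fun y hy => ?_) (fun y hy => ?_) hew
    · rw [← h1, ← integral_neg, ← integral_add hew]
      · refine integral_congr_ae (Eventually.of_forall fun y => ?_)
        simp only
        ring
      · refine (((hqc x).sub ((hpc x).const_mul (Complex.I * k))).bdd_mul
          hec.aestronglyMeasurable hbd).const_mul (Complex.I * k) |>.congr ?_
        refine Eventually.of_forall fun y => ?_
        simp only [hD, Pi.sub_apply]
        ring
    · have : D y - D X = (q y - q X) - Complex.I * k * (p y - p X) := by simp only [hD]; ring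
      rw [this, hqf y hy.1, hpq y hy.1, ← integral_const_mul, ← integral_sub]
      · refine integral_congr_ae (Eventually.of_forall fun t => ?_)
        simp only [hD]
        linear_combination (-k ^ 2 * p t) * Complex.I_sq
      · exact ((hpc y).const_mul _).sub hf.integrableOn
      · exact (hqc y).const_mul _
    · rw [← intervalIntegral.integral_of_le hy.1,
        intervalIntegral.integral_eq_sub_of_hasDerivAt (fun t _ => hed t)
          ((continuous_const.mul hec).intervalIntegrable _ _)]
  -- Dividing by |e(X)| leaves weight at most 1 on f over [X, x] and a boundary term at x that dies
  -- as x tends to infinity.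
  have bound : ∀ x, X ≤ x → ‖D X‖ ≤ Real.exp (-k.im * (x - X)) * (K + ‖k‖ * K) + ∫ y, ‖f y‖ := by
    intro x hx
    have h1 : ‖e X * D X‖ ≤ ‖e x * D x‖ + ‖∫ y in Ioc X x, e y * f y‖ := by
      have : e X * D X = e x * D x + ∫ y in Ioc X x, e y * f y := by
        linear_combination -key x hx
      rw [this]; exact norm_add_le _ _
    have h2 : ‖∫ y in Ioc X x, e y * f y‖ ≤ Real.exp (-k.im * X) * ∫ y, ‖f y‖ := by
      refine (norm_integral_le_of_norm_le (hf.norm.integrableOn.const_mul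
        (Real.exp (-k.im * X))) ?_).trans ?_
      · filter_upwards [ae_restrict_mem measurableSet_Ioc] with y hy
        rw [norm_mul, hen]
        have := hy.1.le
        have : -k.im * y ≤ -k.im * X := by nlinarith
        gcongr
      · rw [integral_const_mul]
        exact mul_le_mul_of_nonneg_left (setIntegral_le_integral hf.norm
          (Eventually.of_forall fun y => norm_nonneg _)) (Real.exp_pos _).le
    rw [norm_mul, norm_mul, hen, hen] at h1
    have h3 : Real.exp (-k.im * x) = Real.exp (-k.im * X) * Real.exp (-k.im * (x - X)) := by
      rw [← Real.exp_add]; ring_nf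
    have h4 : Real.exp (-k.im * x) * ‖D x‖ ≤ Real.exp (-k.im * x) * (K + ‖k‖ * K) := by
      gcongr
      exact hDK x
    have h5 : Real.exp (-k.im * X) * ‖D X‖ ≤ Real.exp (-k.im * X) *
        (Real.exp (-k.im * (x - X)) * (K + ‖k‖ * K) + ∫ y, ‖f y‖) := by
      rw [mul_add, ← mul_assoc, ← h3]
      linarith
    exact le_of_mul_le_mul_left h5 (Real.exp_pos _)
  have hlim : Tendsto (fun x => Real.exp (-k.im * (x - X)) * (K + ‖k‖ * K) + ∫ y, ‖f y‖) atTop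
      (nhds (0 * (K + ‖k‖ * K) + ∫ y, ‖f y‖)) := by
    refine ((Real.tendsto_exp_atBot.comp ?_).mul_const _).add_const _
    refine (tendsto_id.atTop_add tendsto_const_nhds).const_mul_atTop_of_neg (by linarith)
  rw [zero_mul, zero_add] at hlim
  exact ge_of_tendsto hlim (eventually_ge_atTop X |>.mono bound)

theorem setIntegral_Ioc_comp_neg (f : ℝ → ℂ) {a b : ℝ} (hab : a ≤ b) :
    ∫ x in Ioc (-b) (-a), f x = ∫ x in Ioc a b, f (-x) := by
  rw [← intervalIntegral.integral_of_le hab, ← intervalIntegral.integral_of_le (by linarith),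
    intervalIntegral.integral_comp_neg]

theorem SupportedIn.setIntegral_eq_zero {V : SignedMeasure ℝ} {S s : Set ℝ} (hV : SupportedIn V S)
    (hs : s ⊆ Sᶜ) (f : ℝ → ℂ) : (∫ x in s, f x ∂V.toJordanDecomposition.posPart) = 0 ∧
      (∫ x in s, f x ∂V.toJordanDecomposition.negPart) = 0 := by
  have h0 := measure_mono_null hs hV
  rw [SignedMeasure.totalVariation, Measure.coe_add, Pi.add_apply, add_eq_zero] at h0
  rw [Measure.restrict_eq_zero.2 h0.1, Measure.restrict_eq_zero.2 h0.2]
  simp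

theorem abs_im_conj_mul_le (a b : ℂ) : |(conj a * b).im| ≤ ‖a‖ * ‖b‖ := by
  simpa using Complex.abs_im_le_norm (conj a * b)

/-- The energy estimate at the points `±X` outside the support of the potential. -/
theorem IsPointwiseSolution.energy_estimate {h : ℝ} (hh : 0 < h) {V : SignedMeasure ℝ} {R₀ : ℝ}
    (hV : SupportedIn V (Icc (-R₀) R₀)) {k z : ℂ} (hk : 0 < k.im) (hkz : (h : ℂ) ^ 2 * k ^ 2 = z)
    {c v g F : ℝ → ℂ} {K m X : ℝ}
    (hs : IsPointwiseSolution h V c v g) (hc : Continuous c) (hv : LocallyIntegrable v)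
    (hcK : ∀ x, ‖c x‖ ≤ K) (hvK : ∀ x, ‖v x‖ ≤ K) (hg : g =ᵐ[volume] fun x => z * c x + F x)
    (hF : Integrable F) (hF0 : ∀ᵐ x, |x| ≤ R₀ → F x = 0) (hm : ∀ x, R₀ < |x| → ‖c x‖ ≤ m)
    (hR₀ : 0 < R₀) (hX : R₀ < X) :
    h ^ 2 * |k.re| * (‖c X‖ ^ 2 + ‖c (-X)‖ ^ 2 + 2 * k.im * ∫ x in Ioc (-X) X, ‖c x‖ ^ 2) ≤
      (∫ x, ‖F x‖) * (‖c X‖ + ‖c (-X)‖ + m) := by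
  set J := ∫ x, ‖F x‖ with hJ
  have hhC : (h : ℂ) ≠ 0 := by exact_mod_cast hh.ne'
  have hgl : LocallyIntegrable g := by
    have : LocallyIntegrable (fun x => z * c x + F x) :=
      (continuous_const.mul hc).locallyIntegrable.add hF.locallyIntegrable
    exact this.congr hg.symm
  have jump : ∀ a b, a ≤ b → Ioc a b ⊆ (Icc (-R₀) R₀)ᶜ →
      v b - v a = ∫ x in Ioc a b, (-k ^ 2 * c x - F x / (h : ℂ) ^ 2) := by
    intro a b hab hsub
    have h1 := hs.jump a b hab
    rw [(hV.setIntegral_eq_zero hsub c).1, (hV.setIntegral_eq_zero hsub c).2,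
      integral_congr_ae (ae_restrict_of_ae hg)] at h1
    have h2 : (∫ x in Ioc a b, (-k ^ 2 * c x - F x / (h : ℂ) ^ 2)) =
        -((h : ℂ) ^ 2)⁻¹ * ∫ x in Ioc a b, (z * c x + F x) := by
      rw [← integral_const_mul]
      refine integral_congr_ae (Eventually.of_forall fun x => ?_)
      simp only [← hkz]
      field_simp
      ring
    rw [h2]
    field_simp
    linear_combination h1
  have hJh : ∫ x, ‖F x / (h : ℂ) ^ 2‖ = J / h ^ 2 := by
    simp [integral_div, hJ]
  have hright : ‖v X - Complex.I * k * c X‖ ≤ J / h ^ 2 := by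
    rw [← hJh]
    refine norm_outgoing_le hk hc hv (hF.div_const _) (fun x hx => hs.prim X x hx)
      (fun x hx => jump X x hx fun y hy hy' => ?_) hcK hvK
    linarith [hy.1, hy'.2]
  -- The left half-line is reflected onto the right one; the derivative of c(-x) is -v(-x), which
  -- accounts for the sign.
  have hleft : ‖-v (-X) - Complex.I * k * c (-X)‖ ≤ J / h ^ 2 := by
    have hJn : ∫ x, ‖F (-x) / (h : ℂ) ^ 2‖ = J / h ^ 2 :=
      (integral_neg_eq_self (fun x => ‖F x / (h : ℂ) ^ 2‖) volume).trans hJh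
    rw [← hJn]
    refine norm_outgoing_le (p := fun x => c (-x)) (q := fun x => -v (-x))
      (f := fun x => F (-x) / (h : ℂ) ^ 2) hk (hc.comp continuous_neg) ?_
      (hF.comp_neg.div_const _) (fun x hx => ?_) (fun x hx => ?_) (fun x => hcK _)
      (fun x => by rw [norm_neg]; exact hvK _)
    · have hm := (hv.aestronglyMeasurable.comp_measurePreserving
        (Measure.measurePreserving_neg (volume : Measure ℝ))).neg
      exact (memLp_top_of_bound hm K (Eventually.of_forall fun x => by
        simpa using hvK (-x))).locallyIntegrable le_top
    · rw [integral_neg, ← setIntegral_Ioc_comp_neg _ hx, ← hs.prim _ _ (by linarith)]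
      ring
    · rw [← setIntegral_Ioc_comp_neg (fun y => -k ^ 2 * c y - F y / (h : ℂ) ^ 2) hx,
        ← jump _ _ (by linarith)]
      · ring
      · intro y hy hy'
        linarith [hy.2, hy'.1]
  have hflux := hs.flux hc hv hgl (show -X ≤ X by linarith)
  have hsplit : (∫ x in Ioc (-X) X, conj (c x) * g x) =
      z * ((∫ x in Ioc (-X) X, ‖c x‖ ^ 2 : ℝ) : ℂ) + ∫ x in Ioc (-X) X, conj (c x) * F x := by
    have hcF : IntegrableOn (fun x => conj (c x) * F x) (Ioc (-X) X) :=
      hF.integrableOn.bdd_mul (Complex.continuous_conj.comp hc).aestronglyMeasurable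
        (Eventually.of_forall fun x => by simpa using hcK x)
    rw [← integral_complex_ofReal, ← integral_const_mul, ← integral_add _ hcF]
    · refine integral_congr_ae (ae_restrict_of_ae ?_)
      filter_upwards [hg] with x hx
      rw [hx]
      push_cast
      rw [← Complex.conj_mul']
      ring
    · refine Continuous.integrableOn_Ioc ?_
      fun_prop
  -- Since F vanishes on [-R₀, R₀], only exterior values of c occur, so `m` suffices and nothing
  -- need be known about c near the potential.
  have hFb : ‖∫ x in Ioc (-X) X, conj (c x) * F x‖ ≤ m * J := by
    refine (norm_integral_le_of_norm_le ((hF.norm.const_mul m).integrableOn) ?_).trans ?_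
    · refine ae_restrict_of_ae ?_
      filter_upwards [hF0] with x hx
      rw [norm_mul, RCLike.norm_conj]
      rcases le_or_gt |x| R₀ with hx' | hx'
      · simp [hx hx']
      · exact mul_le_mul_of_nonneg_right (hm x hx') (norm_nonneg _)
    · have hm0 : 0 ≤ m := (norm_nonneg _).trans (hm X (by rwa [abs_of_pos (by linarith)]))
      rw [integral_const_mul]
      exact mul_le_mul_of_nonneg_left (setIntegral_le_integral hF.norm
        (Eventually.of_forall fun _ => norm_nonneg _)) hm0
  set I := ∫ x in Ioc (-X) X, ‖c x‖ ^ 2 with hI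
  have hI0 : 0 ≤ I := integral_nonneg fun x => by positivity
  set A := v X - Complex.I * k * c X with hA
  set B := -v (-X) - Complex.I * k * c (-X) with hB
  set T := ∫ x in Ioc (-X) X, conj (c x) * F x
  have eA : conj (c X) * v X = conj (c X) * A + Complex.I * k * ((‖c X‖ ^ 2 : ℝ) : ℂ) := by
    push_cast
    rw [← Complex.conj_mul', hA]; ring
  have eB : conj (c (-X)) * v (-X) =
      -(conj (c (-X)) * B) - Complex.I * k * ((‖c (-X)‖ ^ 2 : ℝ) : ℂ) := by
    push_cast
    rw [← Complex.conj_mul', hB]; ring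
  have hzim : z.im = 2 * h ^ 2 * k.re * k.im := by
    rw [← hkz, ← Complex.ofReal_pow, Complex.im_ofReal_mul, sq k, Complex.mul_im]; ring
  rw [hsplit, eA, eB] at hflux
  simp only [Complex.sub_im, Complex.add_im, Complex.neg_im, Complex.im_mul_ofReal,
    Complex.I_mul_im, hzim] at hflux
  -- The outward derivative at -X is -v(-X), so both boundary terms have the sign of Re k, as does
  -- Im z = 2h² Re k Im k. Taking absolute values therefore treats both signs of Im z at once.
  have hid : h ^ 2 * k.re * (‖c X‖ ^ 2 + ‖c (-X)‖ ^ 2 + 2 * k.im * I) =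
      -(T.im + h ^ 2 * (conj (c X) * A).im + h ^ 2 * (conj (c (-X)) * B).im) := by
    linear_combination hflux
  have habs := congrArg abs hid
  have hn0 : 0 ≤ ‖c X‖ ^ 2 + ‖c (-X)‖ ^ 2 + 2 * k.im * I := by positivity
  rw [abs_mul, abs_mul, abs_neg, abs_of_pos (pow_pos hh 2), abs_of_nonneg hn0] at habs
  rw [habs]
  have hA' := abs_im_conj_mul_le (c X) A
  have hB' := abs_im_conj_mul_le (c (-X)) B
  have hT := (Complex.abs_im_le_norm T).trans hFb
  rw [le_div_iff₀ (by positivity)] at hright hleft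
  have h3 : h ^ 2 * |(conj (c X) * A).im| ≤ J * ‖c X‖ := by
    nlinarith [norm_nonneg (c X), sq_nonneg h]
  have h4 : h ^ 2 * |(conj (c (-X)) * B).im| ≤ J * ‖c (-X)‖ := by
    nlinarith [norm_nonneg (c (-X)), sq_nonneg h]
  refine (abs_add_three _ _ _).trans ?_
  rw [abs_mul, abs_mul, abs_of_pos (pow_pos hh 2)]
  linarith

end ExteriorEstimate

/-! ### Uniqueness and the L¹ → L∞ bound outside the support. -/

section SolutionEstimates

open Set

theorem IsSchrodingerPair.exists_pointwiseSolution {h : ℝ} (hh : 0 < h) {V : SignedMeasure ℝ}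
    {u g : L2} (H : IsSchrodingerPair h V u g) :
    ∃ c v K, IsContRep u c ∧ LocallyIntegrable v ∧ IsPointwiseSolution h V c v g ∧
      (∀ x, ‖c x‖ ≤ K) ∧ ∀ x, ‖v x‖ ≤ K := by
  obtain ⟨v, hv, -, c, hc, hS⟩ := H
  obtain ⟨v', hvv, hs⟩ := hS.exists_pointwiseSolution hh.ne' hv hc
  obtain ⟨K, hK⟩ := hs.exists_bound hh hc hvv
  exact ⟨c, v', K, hc, (L2.locallyIntegrable v).congr hvv, hs, fun x => (hK x).1, fun x => (hK x).2⟩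

theorem exists_sq_eq_of_im_ne_zero {h : ℝ} (hh : 0 < h) {z : ℂ} (hz : z.im ≠ 0) :
    ∃ k : ℂ, 0 < k.im ∧ (h : ℂ) ^ 2 * k ^ 2 = z := by
  have hhC : (h : ℂ) ≠ 0 := by exact_mod_cast hh.ne'
  obtain ⟨κ, hκ⟩ := IsAlgClosed.exists_pow_nat_eq z two_pos
  have him : κ.im ≠ 0 := by
    rintro h0
    apply hz
    rw [← hκ, sq, Complex.mul_im, h0]
    ring
  have hk : ∀ k : ℂ, k ^ 2 = z → (h : ℂ) ^ 2 * (k / h) ^ 2 = z := by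
    rintro k rfl
    field_simp
  rcases him.lt_or_gt with h1 | h1
  · refine ⟨-κ / h, ?_, hk _ (by rw [neg_sq, hκ])⟩
    rw [Complex.div_ofReal_im, Complex.neg_im]
    exact div_pos (by linarith) hh
  · refine ⟨κ / h, ?_, hk _ hκ⟩
    rw [Complex.div_ofReal_im]
    exact div_pos h1 hh

/-- Re z = h²((Re k)² - (Im k)²). This makes the lower bound for h|Re k| depend on Re z alone, hence
uniform in ε. -/
theorem sqrt_re_le_mul_abs_re {h : ℝ} (hh : 0 < h) {k z : ℂ} (hkz : (h : ℂ) ^ 2 * k ^ 2 = z) :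
    √z.re ≤ h * |k.re| := by
  refine Real.sqrt_le_iff.2 ⟨by positivity, ?_⟩
  rw [← hkz, ← Complex.ofReal_pow, Complex.re_ofReal_mul, sq k, Complex.mul_re, mul_pow, sq_abs]
  nlinarith [mul_nonneg (sq_nonneg h) (sq_nonneg k.im)]

/-- Uniqueness for `(P - z) u = 0`, `z` not real. -/
theorem IsSchrodingerPair.eq_zero_of_eigen {h : ℝ} (hh : 0 < h) {V : SignedMeasure ℝ} {R₀ : ℝ}
    (hR₀ : 0 < R₀) (hV : SupportedIn V (Icc (-R₀) R₀)) {z : ℂ} (hz : z.im ≠ 0) {u : L2}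
    (H : IsSchrodingerPair h V u (z • u)) : u = 0 := by
  obtain ⟨k, hk, hkz⟩ := exists_sq_eq_of_im_ne_zero hh hz
  obtain ⟨c, v, K, hc, hv, hs, hcK, hvK⟩ := H.exists_pointwiseSolution hh
  have hre : k.re ≠ 0 := by
    rintro h0
    apply hz
    rw [← hkz, ← Complex.ofReal_pow, Complex.im_ofReal_mul, sq k, Complex.mul_im, h0]
    ring
  have hg : (z • u : L2) =ᵐ[volume] fun x => z * c x + (fun _ => 0 : ℝ → ℂ) x := by
    filter_upwards [Lp.coeFn_smul z u, hc.2] with x h1 h2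
    rw [h1, Pi.smul_apply, h2, smul_eq_mul, add_zero]
  -- With F = 0 the right side of the energy estimate is zero, so all three nonnegative terms
  -- vanish.
  have key : ∀ X, R₀ < X →
      ‖c X‖ ^ 2 + ‖c (-X)‖ ^ 2 + 2 * k.im * ∫ x in Ioc (-X) X, ‖c x‖ ^ 2 ≤ 0 := by
    intro X hX
    have h1 := hs.energy_estimate hh hV hk hkz hc.1 hv hcK hvK hg (integrable_zero _ _ _)
      (Filter.Eventually.of_forall fun _ _ => rfl) (fun x _ => hcK x) hR₀ hX
    simp only [norm_zero, integral_zero, zero_mul] at h1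
    exact nonpos_of_mul_nonpos_right h1 (mul_pos (pow_pos hh 2) (abs_pos.2 hre))
  have hI : ∀ X, 0 ≤ k.im * ∫ x in Ioc (-X) X, ‖c x‖ ^ 2 := fun X =>
    mul_nonneg hk.le (integral_nonneg fun x => by positivity)
  have hext : ∀ x ∉ Ioc (-(R₀ + 1)) (R₀ + 1), ‖c x‖ ^ 2 = 0 := by
    intro x hx
    have h0 : R₀ < |x| := by
      by_contra! h
      obtain ⟨h1, h2⟩ := abs_le.1 h
      exact hx ⟨by linarith, by linarith⟩
    have h1 := key _ h0
    have h2 := hI |x|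
    rcases abs_choice x with h3 | h3 <;> rw [h3] at h1 h2 <;>
      (try rw [neg_neg] at h1 h2) <;>
      nlinarith [sq_nonneg ‖c x‖, sq_nonneg ‖c (-x)‖]
  have h1 := key (R₀ + 1) (by linarith)
  rw [setIntegral_eq_integral_of_forall_compl_eq_zero hext] at h1
  have h2 : ∫ x, ‖c x‖ ^ 2 = ‖u‖ ^ 2 := by
    rw [L2.norm_sq_eq_integral]
    exact integral_congr_ae (hc.2.mono fun x hx => by simp only [hx])
  rw [h2] at h1
  have h3 : k.im * ‖u‖ ^ 2 ≤ 0 := by nlinarith [sq_nonneg ‖c (R₀ + 1)‖, sq_nonneg ‖c (-(R₀ + 1))‖]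
  have h4 : ‖u‖ ^ 2 ≤ 0 := nonpos_of_mul_nonpos_right h3 hk
  exact norm_eq_zero.1 (pow_eq_zero_iff two_ne_zero |>.1 (le_antisymm h4 (sq_nonneg _)))

/-- Away from the support of the potential, solutions of `(P - z) u = f` are bounded by the `L¹`
norm of `f`, provided `f` vanishes near the potential. -/
theorem IsSchrodingerPair.exterior_bound {h : ℝ} (hh : 0 < h) {V : SignedMeasure ℝ} {R₀ : ℝ}
    (hR₀ : 0 < R₀) (hV : SupportedIn V (Icc (-R₀) R₀)) {z : ℂ} (hz : z.im ≠ 0) (hz' : 0 < z.re)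
    {u f : L2} (H : IsSchrodingerPair h V u (f + z • u)) (hf : Integrable f)
    (hf0 : ∀ᵐ x, |x| ≤ R₀ → f x = 0) :
    ∀ᵐ x, R₀ < |x| → ‖u x‖ ≤ 3 / (√z.re * h) * ∫ x, ‖f x‖ := by
  obtain ⟨k, hk, hkz⟩ := exists_sq_eq_of_im_ne_zero hh hz
  obtain ⟨c, v, K, hc, hv, hs, hcK, hvK⟩ := H.exists_pointwiseSolution hh
  have hg : (f + z • u : L2) =ᵐ[volume] fun x => z * c x + f x := by
    filter_upwards [Lp.coeFn_add f (z • u), Lp.coeFn_smul z u, hc.2] with x h0 h1 h2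
    rw [h0, Pi.add_apply, h1, Pi.smul_apply, h2, smul_eq_mul, add_comm]
  set J := ∫ x, ‖f x‖ with hJ
  have hJ0 : 0 ≤ J := integral_nonneg fun _ => norm_nonneg _
  have hsq := sqrt_re_le_mul_abs_re hh hkz
  have hsq0 : 0 < √z.re := Real.sqrt_pos.2 hz'
  set S := (fun x => ‖c x‖) '' {x | R₀ < |x|} with hS
  have hbdd : BddAbove S := ⟨K, by rintro _ ⟨x, -, rfl⟩; exact hcK x⟩
  have hmem : R₀ + 1 ∈ {x : ℝ | R₀ < |x|} := by
    rw [mem_ofPred_eq, abs_of_pos (by linarith)]; linarith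
  have hne : S.Nonempty := ⟨_, mem_image_of_mem _ hmem⟩
  set m := sSup S with hm
  have hle : ∀ x, R₀ < |x| → ‖c x‖ ≤ m := fun x hx => le_csSup hbdd (mem_image_of_mem _ hx)
  have hm0 : 0 ≤ m := (norm_nonneg _).trans (hle _ hmem)
  have hpos : ∀ X, R₀ < X → √z.re * h * (‖c X‖ ^ 2 + ‖c (-X)‖ ^ 2) ≤ 3 * J * m := by
    intro X hX
    have h1 := hs.energy_estimate hh hV hk hkz hc.1 hv hcK hvK hg hf hf0 hle hR₀ hX
    have h2 : ‖c X‖ + ‖c (-X)‖ + m ≤ 3 * m := by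
      have := hle X (by rwa [abs_of_pos (by linarith)])
      have := hle (-X) (by rwa [abs_neg, abs_of_pos (by linarith)])
      linarith
    have hI : 0 ≤ ∫ x in Ioc (-X) X, ‖c x‖ ^ 2 := integral_nonneg fun x => by positivity
    calc √z.re * h * (‖c X‖ ^ 2 + ‖c (-X)‖ ^ 2)
        ≤ h * |k.re| * h * (‖c X‖ ^ 2 + ‖c (-X)‖ ^ 2 + 2 * k.im * ∫ x in Ioc (-X) X, ‖c x‖ ^ 2) := by
          have := mul_nonneg hk.le hI
          exact mul_le_mul (by gcongr) (by linarith) (by positivity) (by positivity)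
      _ ≤ J * (‖c X‖ + ‖c (-X)‖ + m) := by
          refine le_trans (le_of_eq ?_) h1
          ring
      _ ≤ 3 * J * m := by nlinarith
  have hall : ∀ x, R₀ < |x| → √z.re * h * ‖c x‖ ^ 2 ≤ 3 * J * m := by
    intro x hx
    refine le_trans ?_ (hpos _ hx)
    have hp : 0 ≤ √z.re * h := by positivity
    refine mul_le_mul_of_nonneg_left ?_ hp
    rcases abs_choice x with h1 | h1 <;> rw [h1] <;>
      simp
  -- Absorption of one factor m. The supremum need not be attained, so the quadratic bound on each
  -- value passes to m through a square root.
  have hmm : √z.re * h * m ≤ 3 * J := by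
    by_contra! hlt
    have hmpos : 0 < m := by
      by_contra! hm'
      have : √z.re * h * m ≤ 0 := mul_nonpos_of_nonneg_of_nonpos (by positivity) hm'
      linarith
    have hb : m ≤ √(3 * J * m / (√z.re * h)) := by
      refine csSup_le hne ?_
      rintro _ ⟨x, hx, rfl⟩
      refine Real.le_sqrt_of_sq_le ?_
      rw [le_div_iff₀ (by positivity)]
      linarith [hall x hx]
    have h2 := (Real.le_sqrt hm0 (by positivity)).1 hb
    rw [le_div_iff₀ (by positivity)] at h2
    nlinarith
  filter_upwards [hc.2] with x hx hR
  rw [hx, div_mul_eq_mul_div, le_div_iff₀ (by positivity)]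
  have := mul_le_mul_of_nonneg_left (hle x hR) (show 0 ≤ √z.re * h by positivity)
  linarith

end SolutionEstimates

/-! ### The form of P - z on H¹ and weak solvability. -/

section SobolevSpace

open Set
open scoped ComplexConjugate BoundedContinuousFunction InnerProductSpace

theorem IsTest.conj {φ : ℝ → ℂ} (hφ : IsTest φ) : IsTest (fun x => conj (φ x)) :=
  ⟨Complex.conjCLE.contDiff.comp hφ.1, hφ.2.comp_left (map_zero _)⟩

theorem deriv_conj (φ : ℝ → ℂ) :
    _root_.deriv (fun x => conj (φ x)) = fun x => conj (_root_.deriv φ x) :=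
  deriv.star' (f := φ)

/-- A test function as an element of `L²`. -/
def IsTest.toL2 {φ : ℝ → ℂ} (hφ : IsTest φ) : L2 :=
  (hφ.1.continuous.memLp_of_hasCompactSupport hφ.2).toLp φ

theorem IsTest.coeFn_toL2 {φ : ℝ → ℂ} (hφ : IsTest φ) : hφ.toL2 =ᵐ[volume] φ :=
  MemLp.coeFn_toLp _

theorem IsTest.inner_conj_toL2 {φ : ℝ → ℂ} (hφ : IsTest φ) (u : L2) :
    ⟪hφ.conj.toL2, u⟫_ℂ = ∫ x, u x * φ x := by
  rw [MeasureTheory.L2.inner_def]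
  refine integral_congr_ae ?_
  filter_upwards [hφ.conj.coeFn_toL2] with x hx
  rw [hx]
  simp

/-- In this form the condition is visibly linear and closed in (u, v), which makes H¹ a Hilbert
space. The conjugates compensate the conjugate-linear first slot. -/
theorem hasWeakDeriv_iff_inner {u v : L2} : HasWeakDeriv u v ↔
    ∀ (φ : ℝ → ℂ) (hφ : IsTest φ), ⟪hφ.deriv.conj.toL2, u⟫_ℂ + ⟪hφ.conj.toL2, v⟫_ℂ = 0 := by
  refine forall₂_congr fun φ hφ => ?_
  rw [hφ.deriv.inner_conj_toL2, hφ.inner_conj_toL2, eq_neg_iff_add_eq_zero]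

/-- The Sobolev space `H¹(ℝ)`, as the space of pairs `(u, u')`. -/
def sobolevSpace : Submodule ℂ (WithLp 2 (L2 × L2)) where
  carrier := {p | HasWeakDeriv p.fst p.snd}
  add_mem' := fun {p q} hp hq => by
    rw [mem_ofPred_eq, hasWeakDeriv_iff_inner] at *
    intro φ hφ
    rw [WithLp.add_fst, WithLp.add_snd, inner_add_right, inner_add_right]
    linear_combination hp φ hφ + hq φ hφ
  zero_mem' := by
    rw [mem_ofPred_eq, hasWeakDeriv_iff_inner]
    simp
  smul_mem' := fun a p hp => by
    rw [mem_ofPred_eq, hasWeakDeriv_iff_inner] at *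
    intro φ hφ
    rw [WithLp.smul_fst, WithLp.smul_snd, inner_smul_right, inner_smul_right]
    linear_combination a * hp φ hφ

theorem isClosed_sobolevSpace : IsClosed (sobolevSpace : Set (WithLp 2 (L2 × L2))) := by
  have : (sobolevSpace : Set (WithLp 2 (L2 × L2))) = ⋂ (φ : ℝ → ℂ) (hφ : IsTest φ),
      {p | ⟪hφ.deriv.conj.toL2, p.fst⟫_ℂ + ⟪hφ.conj.toL2, p.snd⟫_ℂ = 0} := by
    ext p
    simp only [mem_iInter, mem_ofPred_eq]
    exact hasWeakDeriv_iff_inner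
  rw [this]
  refine isClosed_iInter fun φ => isClosed_iInter fun hφ => isClosed_eq ?_ continuous_const
  exact (continuous_const.inner (WithLp.fstL 2 ℂ L2 L2).continuous).add
    (continuous_const.inner (WithLp.sndL 2 ℂ L2 L2).continuous)

instance : CompleteSpace sobolevSpace := isClosed_sobolevSpace.completeSpace_coe

/-- The inclusion of `H¹` into `L²`. -/
def sobolevFst : sobolevSpace →L[ℂ] L2 := WithLp.fstL 2 ℂ L2 L2 ∘L sobolevSpace.subtypeL

/-- The weak derivative, from `H¹` to `L²`. -/
def sobolevSnd : sobolevSpace →L[ℂ] L2 := WithLp.sndL 2 ℂ L2 L2 ∘L sobolevSpace.subtypeL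

theorem hasWeakDeriv_sobolev (U : sobolevSpace) : HasWeakDeriv (sobolevFst U) (sobolevSnd U) := U.2

theorem norm_sq_sobolev (U : sobolevSpace) :
    ‖U‖ ^ 2 = ‖sobolevFst U‖ ^ 2 + ‖sobolevSnd U‖ ^ 2 :=
  WithLp.prod_norm_sq_eq_of_L2 (U : WithLp 2 (L2 × L2))

/-- The continuous representative of an element of `H¹`. -/
def sobolevRep (U : sobolevSpace) : ℝ → ℂ := (hasWeakDeriv_sobolev U).exists_contRep.choose

theorem isContRep_sobolevRep (U : sobolevSpace) : IsContRep (sobolevFst U) (sobolevRep U) :=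
  (hasWeakDeriv_sobolev U).exists_contRep.choose_spec.1

theorem norm_sobolevRep_le (U : sobolevSpace) {l : ℝ} (hl : 0 < l) (x : ℝ) :
    ‖sobolevRep U x‖ ≤ ‖sobolevFst U‖ / √l + √l * ‖sobolevSnd U‖ :=
  (isContRep_sobolevRep U).norm_le (hasWeakDeriv_sobolev U).exists_contRep.choose_spec.2 hl x

theorem norm_sobolevRep_le_norm (U : sobolevSpace) (x : ℝ) : ‖sobolevRep U x‖ ≤ 2 * ‖U‖ := by
  have h := norm_sobolevRep_le U one_pos x
  have h1 := norm_sq_sobolev U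
  rw [Real.sqrt_one, div_one, one_mul] at h
  have h2 : ‖sobolevFst U‖ ≤ ‖U‖ := abs_le_of_sq_le_sq' (by nlinarith) (norm_nonneg _) |>.2
  have h3 : ‖sobolevSnd U‖ ≤ ‖U‖ := abs_le_of_sq_le_sq' (by nlinarith) (norm_nonneg _) |>.2
  linarith

/-- The Sobolev embedding of `H¹` into the bounded continuous functions. -/
def sobolevEmbedding : sobolevSpace →L[ℂ] (ℝ →ᵇ ℂ) :=
  LinearMap.mkContinuous
    { toFun := fun U => BoundedContinuousFunction.ofNormedAddCommGroup (sobolevRep U)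
        (isContRep_sobolevRep U).1 (2 * ‖U‖) (norm_sobolevRep_le_norm U)
      map_add' := fun U W => by
        ext1 x
        refine congrFun ((isContRep_sobolevRep (U + W)).unique
          (c' := fun x => sobolevRep U x + sobolevRep W x)
          ⟨(isContRep_sobolevRep U).1.add (isContRep_sobolevRep W).1, ?_⟩) x
        rw [map_add]
        filter_upwards [Lp.coeFn_add (sobolevFst U) (sobolevFst W), (isContRep_sobolevRep U).2,
          (isContRep_sobolevRep W).2] with y h1 h2 h3
        rw [h1, Pi.add_apply, h2, h3]
      map_smul' := fun a U => by
        ext1 x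
        refine congrFun ((isContRep_sobolevRep (a • U)).unique (c' := fun x => a * sobolevRep U x)
          ⟨(isContRep_sobolevRep U).1.const_mul a, ?_⟩) x
        rw [map_smul]
        filter_upwards [Lp.coeFn_smul a (sobolevFst U), (isContRep_sobolevRep U).2] with y h1 h2
        rw [h1, Pi.smul_apply, h2, smul_eq_mul] }
    2 fun U => (BoundedContinuousFunction.norm_le (by positivity)).2 (norm_sobolevRep_le_norm U)

theorem norm_sobolevEmbedding_le (U : sobolevSpace) {l : ℝ} (hl : 0 < l) :
    ‖sobolevEmbedding U‖ ≤ ‖sobolevFst U‖ / √l + √l * ‖sobolevSnd U‖ :=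
  (BoundedContinuousFunction.norm_le (by positivity)).2 (norm_sobolevRep_le U hl)

/-- Restriction of elements of `H¹` to a finite measure. -/
def sobolevTrace (μ : Measure ℝ) [IsFiniteMeasure μ] : sobolevSpace →L[ℂ] Lp ℂ 2 μ :=
  BoundedContinuousFunction.toLp 2 μ ℂ ∘L sobolevEmbedding

theorem inner_sobolevTrace (μ : Measure ℝ) [IsFiniteMeasure μ] (U W : sobolevSpace) :
    ⟪sobolevTrace μ U, sobolevTrace μ W⟫_ℂ = ∫ x, sobolevRep W x * conj (sobolevRep U x) ∂μ :=
  BoundedContinuousFunction.inner_toLp μ (sobolevEmbedding U) (sobolevEmbedding W)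

/-- The trace is bounded relative to the derivative, with arbitrarily small relative bound. -/
theorem exists_norm_sq_sobolevTrace_le (μ : Measure ℝ) [IsFiniteMeasure μ] {η : ℝ} (hη : 0 < η) :
    ∃ D, 0 ≤ D ∧ ∀ U, ‖sobolevTrace μ U‖ ^ 2 ≤ D * ‖sobolevFst U‖ ^ 2 + η * ‖sobolevSnd U‖ ^ 2 := by
  set N := ‖(BoundedContinuousFunction.toLp 2 μ ℂ : (ℝ →ᵇ ℂ) →L[ℂ] Lp ℂ 2 μ)‖
  -- Chosen so that 2N²l ≤ η; the added 1 covers N = 0.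
  set l := η / (2 * N ^ 2 + 1) with hl
  have hl0 : 0 < l := by positivity
  refine ⟨2 * N ^ 2 / l, by positivity, fun U => ?_⟩
  have h1 : ‖sobolevTrace μ U‖ ≤ N * (‖sobolevFst U‖ / √l + √l * ‖sobolevSnd U‖) :=
    ((BoundedContinuousFunction.toLp 2 μ ℂ).le_opNorm (sobolevEmbedding U)).trans
      (mul_le_mul_of_nonneg_left (norm_sobolevEmbedding_le U hl0) (norm_nonneg _))
  have h2 : 2 * N ^ 2 * l ≤ η := by
    rw [hl, mul_div_assoc', div_le_iff₀ (by positivity)]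
    nlinarith
  calc ‖sobolevTrace μ U‖ ^ 2 ≤ (N * (‖sobolevFst U‖ / √l + √l * ‖sobolevSnd U‖)) ^ 2 := by gcongr
    _ ≤ N ^ 2 * (2 * ((‖sobolevFst U‖ / √l) ^ 2 + (√l * ‖sobolevSnd U‖) ^ 2)) := by
        rw [mul_pow]
        gcongr
        exact add_sq_le
    _ = 2 * N ^ 2 / l * ‖sobolevFst U‖ ^ 2 + 2 * N ^ 2 * l * ‖sobolevSnd U‖ ^ 2 := by
        rw [div_pow, mul_pow, Real.sq_sqrt hl0.le]; ring
    _ ≤ _ := by gcongr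

/-- The operator on `H¹` representing the sesquilinear form of `P - z`. -/
def formOp (h : ℝ) (V : SignedMeasure ℝ) (z : ℂ) : sobolevSpace →L[ℂ] sobolevSpace :=
  ((h : ℂ) ^ 2) • (sobolevSnd.adjoint ∘L sobolevSnd)
    + (sobolevTrace V.toJordanDecomposition.posPart).adjoint ∘L
        sobolevTrace V.toJordanDecomposition.posPart
    - (sobolevTrace V.toJordanDecomposition.negPart).adjoint ∘L
        sobolevTrace V.toJordanDecomposition.negPart
    - z • (sobolevFst.adjoint ∘L sobolevFst)

theorem inner_formOp (h : ℝ) (V : SignedMeasure ℝ) (z : ℂ) (W U : sobolevSpace) :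
    ⟪W, formOp h V z U⟫_ℂ = (h : ℂ) ^ 2 * ⟪sobolevSnd W, sobolevSnd U⟫_ℂ
      + ⟪sobolevTrace V.toJordanDecomposition.posPart W,
          sobolevTrace V.toJordanDecomposition.posPart U⟫_ℂ
      - ⟪sobolevTrace V.toJordanDecomposition.negPart W,
          sobolevTrace V.toJordanDecomposition.negPart U⟫_ℂ
      - z * ⟪sobolevFst W, sobolevFst U⟫_ℂ := by
  have hsmul : ∀ (a : ℂ) (X Y : sobolevSpace), ⟪X, a • Y⟫_ℂ = a * ⟪X, Y⟫_ℂ := fun a X Y =>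
    inner_smul_right X Y a
  simp only [formOp, sub_apply, add_apply, smul_apply, ContinuousLinearMap.comp_apply,
    inner_sub_right, inner_add_right, hsmul, ContinuousLinearMap.adjoint_inner_right]

/-- Coercivity in the Lax–Milgram sense: |⟨U, AU⟩| ≥ Q⁻¹‖U‖². The negative part of V costs at most
half of h²‖u'‖² plus a multiple of ‖u‖², by the small relative trace bound. -/
theorem isUnit_formOp {h : ℝ} (hh : 0 < h) (V : SignedMeasure ℝ) {z : ℂ} (hz : z.im ≠ 0) :
    IsUnit (formOp h V z) := by
  obtain ⟨D, hD0, hD⟩ := exists_norm_sq_sobolevTrace_le V.toJordanDecomposition.negPart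
    (show 0 < h ^ 2 / 2 by positivity)
  set s := |z.im| with hs
  have hs0 : 0 < s := abs_pos.2 hz
  set Q := 1 / s + 2 / h ^ 2 * (1 + (|z.re| + D) / s) with hQ
  have hQ0 : 0 < Q := by positivity
  refine ContinuousLinearMap.isUnit_of_forall_le_norm_inner_map (c := Real.toNNReal Q⁻¹)
    (formOp h V z) (Real.toNNReal_pos.2 (inv_pos.2 hQ0)) fun U => ?_
  rw [Real.coe_toNNReal _ (inv_pos.2 hQ0).le, ← norm_inner_symm U, ← div_eq_mul_inv,
    div_le_iff₀ hQ0]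
  set T := ‖⟪U, formOp h V z U⟫_ℂ‖ with hT
  have hre := Complex.abs_re_le_norm ⟪U, formOp h V z U⟫_ℂ
  have him := Complex.abs_im_le_norm ⟪U, formOp h V z U⟫_ℂ
  rw [← hT] at hre him
  rw [inner_formOp] at hre him
  simp only [inner_self_eq_norm_sq_to_K, Complex.coe_algebraMap, ← Complex.ofReal_pow,
    Complex.sub_re, Complex.add_re, Complex.sub_im, Complex.add_im, Complex.re_mul_ofReal,
    Complex.im_mul_ofReal, Complex.ofReal_re, Complex.ofReal_im] at hre him
  -- On the diagonal every term except z‖u‖² is real, so the imaginary part isolates ‖u‖².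
  have hx : ‖sobolevFst U‖ ^ 2 ≤ T / s := by
    rw [le_div_iff₀ hs0]
    refine le_trans (le_of_eq ?_) him
    rw [hs, ← abs_of_nonneg (sq_nonneg ‖sobolevFst U‖), ← abs_mul, ← abs_neg]
    congr 1
    rw [abs_of_nonneg (sq_nonneg ‖sobolevFst U‖)]
    ring
  have hzr : z.re * ‖sobolevFst U‖ ^ 2 ≤ |z.re| * ‖sobolevFst U‖ ^ 2 := by
    gcongr
    exact le_abs_self _
  have hy : h ^ 2 / 2 * ‖sobolevSnd U‖ ^ 2 ≤ T + (|z.re| + D) * ‖sobolevFst U‖ ^ 2 := by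
    have h1 := (le_abs_self _).trans hre
    have h2 := hD U
    have h3 := sq_nonneg ‖sobolevTrace V.toJordanDecomposition.posPart U‖
    linarith
  have hy' : ‖sobolevSnd U‖ ^ 2 ≤ 2 / h ^ 2 * (T + (|z.re| + D) * (T / s)) := by
    have h1 : (|z.re| + D) * ‖sobolevFst U‖ ^ 2 ≤ (|z.re| + D) * (T / s) := by gcongr
    have h2 : ‖sobolevSnd U‖ ^ 2 = 2 / h ^ 2 * (h ^ 2 / 2 * ‖sobolevSnd U‖ ^ 2) := by field_simp
    rw [h2]
    gcongr
    linarith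
  rw [norm_sq_sobolev]
  refine (add_le_add hx hy').trans (le_of_eq ?_)
  rw [hQ]
  ring

/-- A test function as an element of `H¹`. -/
def IsTest.toSobolev {φ : ℝ → ℂ} (hφ : IsTest φ) : sobolevSpace :=
  ⟨WithLp.toLp 2 (hφ.toL2, hφ.deriv.toL2), by
    intro χ hχ
    have h1 := hφ.isPrimitive.integral_test hφ.deriv.1.continuous.locallyIntegrable hχ
    refine Eq.trans (integral_congr_mul hφ.coeFn_toL2) (h1.trans ?_)
    exact congrArg _ (integral_congr_mul hφ.deriv.coeFn_toL2).symm⟩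

theorem IsTest.sobolevRep_toSobolev {φ : ℝ → ℂ} (hφ : IsTest φ) :
    sobolevRep hφ.toSobolev = φ :=
  (isContRep_sobolevRep _).unique ⟨hφ.1.continuous, hφ.coeFn_toL2⟩

/-- Weak solvability of `(P - z) u = f`. -/
theorem exists_weak_resolvent {h : ℝ} (hh : 0 < h) (V : SignedMeasure ℝ) {z : ℂ} (hz : z.im ≠ 0) :
    ∃ R : L2 →L[ℂ] L2, ∀ f, IsSchrodingerPair h V (R f) (f + z • R f) := by
  obtain ⟨B, hB⟩ := (isUnit_formOp hh V hz).exists_right_inv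
  refine ⟨sobolevFst ∘L B ∘L sobolevFst.adjoint, fun f => ?_⟩
  set U := B (sobolevFst.adjoint f) with hU
  have hAU : formOp h V z U = sobolevFst.adjoint f := congrArg (fun T => T (sobolevFst.adjoint f)) hB
  change IsSchrodingerPair h V (sobolevFst U) (f + z • sobolevFst U)
  have hS : SchrodingerEq h V (sobolevFst U) (sobolevRep U) (f + z • sobolevFst U : L2) := by
    intro φ hφ
    have h1 := inner_formOp h V z hφ.conj.toSobolev U
    rw [hAU, ContinuousLinearMap.adjoint_inner_right, inner_sobolevTrace, inner_sobolevTrace,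
      hφ.conj.sobolevRep_toSobolev] at h1
    have e1 : ∀ w, ⟪sobolevFst hφ.conj.toSobolev, w⟫_ℂ = ∫ x, w x * φ x := hφ.inner_conj_toL2
    have e2 : ∀ w, ⟪sobolevSnd hφ.conj.toSobolev, w⟫_ℂ = ∫ x, w x * _root_.deriv φ x := by
      intro w
      rw [← hφ.deriv.inner_conj_toL2]
      congr 1
      refine Lp.ext (hφ.conj.deriv.coeFn_toL2.trans ?_)
      rw [deriv_conj]
      exact hφ.deriv.conj.coeFn_toL2.symm
    rw [e1, e1, e2] at h1
    have h2 := hasWeakDeriv_sobolev U _ hφ.deriv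
    have h3 := hφ.inner_conj_toL2 (f + z • sobolevFst U)
    rw [inner_add_right, inner_smul_right, hφ.inner_conj_toL2, hφ.inner_conj_toL2] at h3
    simp only [Complex.conj_conj] at h1
    rw [iteratedDeriv_succ, iteratedDeriv_one, h2, ← h3, signedIntegral]
    linear_combination h1
  -- The domain also demands a bounded derivative, which H¹ does not supply; it comes from the
  -- equation.
  obtain ⟨v', hv', hs⟩ := hS.exists_pointwiseSolution hh.ne' (hasWeakDeriv_sobolev U)
    (isContRep_sobolevRep U)
  obtain ⟨K, hK⟩ := hs.exists_bound hh (isContRep_sobolevRep U) hv'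
  refine ⟨sobolevSnd U, hasWeakDeriv_sobolev U, ?_, _, isContRep_sobolevRep U, hS⟩
  refine memLp_top_of_bound (Lp.aestronglyMeasurable _) K ?_
  filter_upwards [hv'] with x hx
  rw [hx]
  exact (hK x).2

end SobolevSpace

/-! ### The two-sided resolvent and its weighted norm. -/

section Resolvent

open Set

/-- Weak solvability is the right inverse. For the left inverse, the difference R(A - z)u - u solves
the homogeneous equation and so vanishes. -/
theorem isResolvent_of_forall_pair {h : ℝ} (hh : 0 < h) {V : SignedMeasure ℝ} {R₀ : ℝ}
    (hR₀ : 0 < R₀) (hV : SupportedIn V (Icc (-R₀) R₀)) {z : ℂ} (hz : z.im ≠ 0) {R : L2 →L[ℂ] L2}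
    (hR : ∀ f, IsSchrodingerPair h V (R f) (f + z • R f)) : IsResolvent (schrodinger h V) z R := by
  refine ⟨fun f => ?_, fun u => ?_⟩
  · have hd := mem_schrodinger_domain.2 ⟨_, hR f⟩
    refine ⟨hd, ?_⟩
    have := (schrodinger h V).mem_graph_snd_inj ((schrodinger h V).mem_graph ⟨R f, hd⟩)
      (mem_schrodinger_graph.2 (hR f)) rfl
    rw [this, add_sub_cancel_right]
  · set g := schrodinger h V u with hg
    have h1 : IsSchrodingerPair h V (u : L2) g :=
      mem_schrodinger_graph.1 ((schrodinger h V).mem_graph u)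
    have h2 := (hR (g - z • (u : L2))).add (h1.smul (-1))
    rw [← sub_eq_zero]
    refine IsSchrodingerPair.eq_zero_of_eigen hh hR₀ hV hz (V := V) ?_
    convert h2 using 1
    · rw [neg_one_smul, sub_eq_add_neg]
    · rw [neg_one_smul, smul_sub]; abel

theorem weightOp_ae {δ : ℝ} (hδ : 0 < δ) (u : L2) :
    weightOp δ hδ u =ᵐ[volume] fun x => weightFun δ x * u x := by
  filter_upwards [mulOp_ae ((memLp_weightFun hδ).toLp _) u, (memLp_weightFun hδ).coeFn_toLp]
    with x h1 h2
  rw [weightOp, h1, h2]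

theorem exteriorOp_ae (R₀ : ℝ) (u : L2) :
    exteriorOp R₀ u =ᵐ[volume] fun x => exteriorFun R₀ x * u x := by
  filter_upwards [mulOp_ae ((memLp_exteriorFun R₀).toLp _) u, (memLp_exteriorFun R₀).coeFn_toLp]
    with x h1 h2
  rw [exteriorOp, h1, h2]

theorem exteriorFun_of_le {R₀ x : ℝ} (hx : |x| ≤ R₀) : exteriorFun R₀ x = 0 :=
  indicator_of_notMem (s := {y : ℝ | R₀ < |y|}) (fun h => not_lt.2 hx h) _

theorem exteriorFun_of_lt {R₀ x : ℝ} (hx : R₀ < |x|) : exteriorFun R₀ x = 1 :=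
  indicator_of_mem (s := {y : ℝ | R₀ < |y|}) hx _

theorem norm_exteriorFun_le (R₀ x : ℝ) : ‖exteriorFun R₀ x‖ ≤ 1 := by
  rcases le_or_gt |x| R₀ with h | h
  · simp [exteriorFun_of_le h]
  · simp [exteriorFun_of_lt h]

/-- The squared weight is (1 + |x|)^{-(1+δ)}, integrable on the line because δ > 0. -/
theorem integrable_norm_weightFun_sq {δ : ℝ} (hδ : 0 < δ) :
    Integrable (fun x => ‖weightFun δ x‖ ^ 2) := by
  have h := integrable_one_add_norm (E := ℝ) (μ := volume) (r := 1 + δ) (by simpa using hδ)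
  refine h.congr (Filter.Eventually.of_forall fun x => ?_)
  have h0 : (0 : ℝ) < |x| + 1 := by positivity
  simp only [weightFun, Complex.norm_real, Real.norm_eq_abs]
  rw [sq_abs, ← Real.rpow_natCast, ← Real.rpow_mul h0.le, add_comm 1 |x|]
  congr 1
  push_cast
  ring

theorem memLp_two_weightFun {δ : ℝ} (hδ : 0 < δ) : MemLp (weightFun δ) 2 :=
  (memLp_two_iff_integrable_sq_norm (memLp_weightFun hδ).aestronglyMeasurable).2
    (integrable_norm_weightFun_sq hδ)

/-- Cauchy–Schwarz against the weight. -/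
theorem integral_norm_weightFun_mul_le {δ : ℝ} (hδ : 0 < δ) (f : L2) :
    Integrable (fun x => weightFun δ x * f x) ∧
      ∫ x, ‖weightFun δ x * f x‖ ≤ √(∫ x, ‖weightFun δ x‖ ^ 2) * ‖f‖ := by
  refine ⟨(memLp_two_weightFun hδ).integrable_mul (Lp.memLp f), ?_⟩
  have h := integral_mul_le_Lp_mul_Lq_of_nonneg (μ := (volume : Measure ℝ))
    (Real.HolderConjugate.two_two) (f := fun x => ‖weightFun δ x‖) (g := fun x => ‖f x‖)
    (Filter.Eventually.of_forall fun _ => norm_nonneg _)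
    (Filter.Eventually.of_forall fun _ => norm_nonneg _)
    (by simpa using (memLp_two_weightFun hδ).norm) (by simpa using (Lp.memLp f).norm)
  simp only [Real.rpow_two, ← Real.sqrt_eq_rpow, ← L2.norm_sq_eq_integral] at h
  rw [Real.sqrt_sq (norm_nonneg f)] at h
  simpa only [norm_mul] using h

/-- The right weight maps L² to L¹, the exterior bound maps L¹ to L∞, and the left weight maps L∞
back to L². Each weight costs the L² norm of the weight, hence its square in total. -/
theorem norm_weighted_resolvent_le {δ : ℝ} (hδ : 0 < δ) {h : ℝ} (hh : 0 < h) {V : SignedMeasure ℝ}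
    {R₀ : ℝ} (hR₀ : 0 < R₀) (hV : SupportedIn V (Icc (-R₀) R₀)) {z : ℂ} (hz : z.im ≠ 0)
    (hz' : 0 < z.re) {R : L2 →L[ℂ] L2} (hR : ∀ f, IsSchrodingerPair h V (R f) (f + z • R f)) :
    ‖weightOp δ hδ ∘L exteriorOp R₀ ∘L R ∘L exteriorOp R₀ ∘L weightOp δ hδ‖ ≤
      3 / (√z.re * h) * ∫ x, ‖weightFun δ x‖ ^ 2 := by
  set W := ∫ x, ‖weightFun δ x‖ ^ 2 with hW
  have hW0 : 0 ≤ W := integral_nonneg fun _ => by positivity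
  refine ContinuousLinearMap.opNorm_le_bound _ (by positivity) fun f => ?_
  set F := exteriorOp R₀ (weightOp δ hδ f) with hF
  set G := weightOp δ hδ (exteriorOp R₀ (R F)) with hG
  change ‖G‖ ≤ _
  have hFae : F =ᵐ[volume] fun x => exteriorFun R₀ x * (weightFun δ x * f x) := by
    filter_upwards [exteriorOp_ae R₀ (weightOp δ hδ f), weightOp_ae hδ f] with x h1 h2
    rw [h1, h2]
  have hGae : G =ᵐ[volume] fun x => weightFun δ x * (exteriorFun R₀ x * R F x) := by
    filter_upwards [weightOp_ae hδ (exteriorOp R₀ (R F)), exteriorOp_ae R₀ (R F)] with x h1 h2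
    rw [h1, h2]
  obtain ⟨hwi, hwb⟩ := integral_norm_weightFun_mul_le hδ f
  have hFi : Integrable F := (hwi.bdd_mul (memLp_exteriorFun R₀).aestronglyMeasurable
    (Filter.Eventually.of_forall (norm_exteriorFun_le R₀))).congr hFae.symm
  have hFb : ∫ x, ‖F x‖ ≤ √W * ‖f‖ := by
    refine (integral_mono_ae hFi.norm hwi.norm ?_).trans hwb
    filter_upwards [hFae] with x hx
    rw [hx, norm_mul]
    exact mul_le_of_le_one_left (norm_nonneg _) (norm_exteriorFun_le R₀ x)
  have hF0 : ∀ᵐ x, |x| ≤ R₀ → F x = 0 := by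
    filter_upwards [hFae] with x hx hxR
    rw [hx, exteriorFun_of_le hxR, zero_mul]
  have hbound := (hR F).exterior_bound hh hR₀ hV hz hz' hFi hF0
  set B := 3 / (√z.re * h) * ∫ x, ‖F x‖ with hB
  have hB0 : 0 ≤ B := mul_nonneg (by positivity) (integral_nonneg fun _ => norm_nonneg _)
  have hGn : ‖G‖ ^ 2 ≤ W * B ^ 2 := by
    rw [L2.norm_sq_eq_integral, hW, ← integral_mul_const]
    refine integral_mono_ae (L2.integrable_norm_sq G)
      ((integrable_norm_weightFun_sq hδ).mul_const _) ?_
    filter_upwards [hGae, hbound] with x hx hb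
    rw [hx, norm_mul, mul_pow]
    refine mul_le_mul_of_nonneg_left ?_ (sq_nonneg _)
    rcases le_or_gt |x| R₀ with hxR | hxR
    · rw [exteriorFun_of_le hxR]; simpa using sq_nonneg B
    · rw [exteriorFun_of_lt hxR, one_mul]
      exact pow_le_pow_left₀ (norm_nonneg _) (hb hxR) 2
  have hGB : ‖G‖ ≤ √W * B := by
    refine abs_le_of_sq_le_sq' ?_ (by positivity) |>.2
    rwa [mul_pow, Real.sq_sqrt hW0]
  calc ‖G‖ ≤ √W * B := hGB
    _ ≤ √W * (3 / (√z.re * h) * (√W * ‖f‖)) := by rw [hB]; gcongr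
    _ = 3 / (√z.re * h) * (√W * √W) * ‖f‖ := by ring
    _ = 3 / (√z.re * h) * W * ‖f‖ := by rw [Real.mul_self_sqrt hW0]

end Resolvent

end

theorem theorem1p4 (δ E R₀ : ℝ) (hδ : 0 < δ) (hE : 0 < E) (hR₀ : 0 < R₀) :
    ∃ C : ℝ, 0 < C ∧
      ∀ h : ℝ, 0 < h → h ≤ 1 / (2 * δ * (1 + R₀) ^ δ) →
      ∀ V : SignedMeasure ℝ, SupportedIn V (Set.Icc (-R₀) R₀) →
      ∀ ε : ℝ, 0 < ε → ε ≤ 1 →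
      ∀ z : ℂ, (z = E - ε * Complex.I ∨ z = E + ε * Complex.I) →
        ∃ R : L2 →L[ℂ] L2, IsResolvent (schrodinger h V) z R ∧
          ‖weightOp δ hδ ∘L exteriorOp R₀ ∘L R ∘L exteriorOp R₀ ∘L weightOp δ hδ‖ ≤ C / h := by
  have hW0 : 0 ≤ ∫ x, ‖weightFun δ x‖ ^ 2 := integral_nonneg fun _ => by positivity
  have hsq : 0 < √E := Real.sqrt_pos.2 hE
  -- The added 1 gives positivity of the constant from mere nonnegativity of the weight integral.
  refine ⟨3 / √E * (∫ x, ‖weightFun δ x‖ ^ 2) + 1, by positivity,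
    fun h hh _ V hV ε hε _ z hz => ?_⟩
  have hre : z.re = E := by rcases hz with rfl | rfl <;> simp
  have him : z.im ≠ 0 := by rcases hz with rfl | rfl <;> simp [hε.ne']
  obtain ⟨R, hR⟩ := exists_weak_resolvent hh V him
  refine ⟨R, isResolvent_of_forall_pair hh hR₀ hV him hR, ?_⟩
  refine (norm_weighted_resolvent_le hδ hh hR₀ hV him (by rwa [hre]) hR).trans ?_
  rw [hre, le_div_iff₀ hh]
  have : 3 / (√E * h) * (∫ x, ‖weightFun δ x‖ ^ 2) * h = 3 / √E * ∫ x, ‖weightFun δ x‖ ^ 2 := by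
    field_simp
  linarith
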